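/- All graphs are finite, undirected and simple. For a connected graph $G$, a set $S\subseteq V(G)$ is a resolving set if for all distinct $v,w\in V(G)$ there is $x\in S$ with $\mathrm{dist}(v,x)\neq\mathrm{dist}(w,x)$; the metric dimension $\beta(G)$ is the minimum cardinality of a resolving set of $G$. Distinct vertices $u,v$ are twins if $N(u)=N(v)$ or $N[u]=N[v]$, where $N(u)$ and $N[u]=N(u)\cup\{u\}$ are the open and closed neighbourhoods; "equal or twins" is an equivalence relation on $V(G)$. The twin graph $G^*$ has the equivalence classes $v^*$ as its vertices, two distinct classes $v^*,w^*$ being adjacent if and only if $vw\in E(G)$ (this does not depend on the representatives). A vertex $v^*$ of $G^*$ is of type $(1)$ if $|v^*|=1$, of type $(K)$ if $|v^*|\ge 2$ and $G[v^*]$ is complete, and of type $(N)$ if $|v^*|\ge2$ and $G[v^*]$ has no edges; it is of type $(1K)$ if it is of type $(1)$ or $(K)$, and of type $(1N)$ if it is of type $(1)$ or $(N)$. Let $\alpha(G^*)$ be the number of vertices of $G^*$ of type $(K)$ or $(N)$. Let $P_{D+1}=(u_0,u_1,\dots,u_D)$ be the path with $D+1$ vertices; for $k\in[3,D-1]$ let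 $P_{D+1,k}$ be the graph obtained from $P_{D+1}$ by adding one vertex adjacent to $u_{k-1}$ only, and for $k\in[2,D-1]$ let $P'_{D+1,k}$ be the graph obtained from $P_{D+1}$ by adding one vertex adjacent to $u_{k-1}$ and $u_k$ only. Here $[a,b]$ is the set of integers $i$ with $a\le i\le b$. Theorem. Let $G$ be a connected graph of order $n$ and diameter $D\ge 3$, and let $G^*$ be its twin graph. Then $\beta(G)=n-D$ if and only if one of the following holds: (1) $G^*\cong P_{D+1}$ and one of the following cases holds: (a) $\alpha(G^*)\le 1$; (b) $\alpha(G^*)=2$, the two vertices of $G^*$ not of type $(1)$ are adjacent, and if one of them is a leaf of type $(K)$ then the other is also of type $(K)$; (c) $\alpha(G^*)=2$, the two vertices of $G^*$ not of type $(1)$ are at distance $2$ in $G^*$, and both are of type $(N)$; (d) $\alpha(G^*)=3$ and there is a vertex of type $(N)$ or $(K)$ adjacent in $G^*$ to two vertices of type $(N)$. (2) $G^*\cong P_{D+1,k}$ for some $k\in[3,D-1]$, the degree-$3$ vertex of $G^*$ is of any type, each neighbour of it in $G^*$ is of type $(1N)$, and every other vertex of $G^*$ is of type $(1)$. (3) $G^*\cong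 P'_{D+1,k}$ for some $k\in[2,D-1]$, the three vertices in the cycle of $G^*$ are of type $(1K)$, and every other vertex of $G^*$ is of type $(1)$. -/

import Mathlib

namespace MetricDim

/-- The vertex `x` resolves the pair `v, w`: its distances to `v` and to `w` are different. -/
def Resolves {V : Type*} (G : SimpleGraph V) (x v w : V) : Prop :=
  G.dist v x ≠ G.dist w x

/-- `S` is a resolving set of `G`: every pair of distinct vertices is resolved by some vertex
of `S`. -/
def IsResolvingSet {V : Type*} (G : SimpleGraph V) (S : Set V) : Prop :=
  ∀ v w : V, v ≠ w → ∃ x ∈ S, Resolves G x v w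

/-- The metric dimension `β(G)`: the minimum cardinality of a resolving set. (In a finite connected
graph the set of all vertices is resolving, so the infimum is an attained minimum.) -/
noncomputable def metricDimension {V : Type*} (G : SimpleGraph V) : ℕ :=
  sInf {m : ℕ | ∃ S : Finset V, S.card = m ∧ IsResolvingSet G (S : Set V)}

/-- Distinct vertices with the same closed neighbourhood. -/
def AdjacentTwins {V : Type*} (G : SimpleGraph V) (u v : V) : Prop :=
  u ≠ v ∧ insert u (G.neighborSet u) = insert v (G.neighborSet v)

/-- Distinct vertices with the same open neighbourhood. -/
def NonadjacentTwins {V : Type*} (G : SimpleGraph V) (u v : V) : Prop :=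
  u ≠ v ∧ G.neighborSet u = G.neighborSet v

/-- Distinct vertices that are adjacent or non-adjacent twins. -/
def Twins {V : Type*} (G : SimpleGraph V) (u v : V) : Prop :=
  AdjacentTwins G u v ∨ NonadjacentTwins G u v

theorem AdjacentTwins.adj_iff {V : Type*} {G : SimpleGraph V} {u v : V}
    (h : AdjacentTwins G u v) (x : V) : (x = u ∨ G.Adj u x) ↔ (x = v ∨ G.Adj v x) := by
  simpa using Set.ext_iff.1 h.2 x

theorem NonadjacentTwins.adj_iff {V : Type*} {G : SimpleGraph V} {u v : V}
    (h : NonadjacentTwins G u v) (x : V) : G.Adj u x ↔ G.Adj v x := by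
  simpa using Set.ext_iff.1 h.2 x

/-- Twins have the same neighbours outside of the pair. -/
theorem Twins.adj_iff {V : Type*} {G : SimpleGraph V} {u v : V} (h : Twins G u v) {x : V}
    (hu : x ≠ u) (hv : x ≠ v) : G.Adj u x ↔ G.Adj v x := by
  rcases h with h | h
  · simpa [hu, hv] using h.adj_iff x
  · exact h.adj_iff x

theorem Twins.symm {V : Type*} {G : SimpleGraph V} {u v : V} (h : Twins G u v) : Twins G v u := by
  rcases h with h | h
  · exact Or.inl ⟨h.1.symm, h.2.symm⟩
  · exact Or.inr ⟨h.1.symm, h.2.symm⟩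

theorem Twins.trans {V : Type*} {G : SimpleGraph V} {u v w : V} (h₁ : Twins G u v)
    (h₂ : Twins G v w) (huw : u ≠ w) : Twins G u w := by
  rcases h₁ with h₁ | h₁ <;> rcases h₂ with h₂ | h₂
  · exact Or.inl ⟨huw, h₁.2.trans h₂.2⟩
  · exfalso
    have a := h₁.adj_iff v
    have b := h₁.adj_iff w
    have c := h₂.adj_iff u
    have d := h₂.adj_iff v
    have n₁ := h₁.1
    have n₂ := h₂.1
    simp only [SimpleGraph.irrefl, G.adj_comm v u, G.adj_comm w u, G.adj_comm w v] at a b c d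
    tauto
  · exfalso
    have a := h₂.adj_iff v
    have b := h₂.adj_iff u
    have c := h₁.adj_iff w
    have d := h₁.adj_iff v
    have n₁ := h₁.1
    have n₂ := h₂.1
    simp only [SimpleGraph.irrefl, G.adj_comm v u, G.adj_comm w u, G.adj_comm w v] at a b c d
    tauto
  · exact Or.inr ⟨huw, h₁.2.trans h₂.2⟩

/-- The relation `u ≡ v`: `u = v` or `u, v` are twins. -/
def twinSetoid {V : Type*} (G : SimpleGraph V) : Setoid V where
  r u v := u = v ∨ Twins G u v
  iseqv :=
    { refl := fun _ => Or.inl rfl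
      symm := by
        rintro u v (h | h)
        · exact Or.inl h.symm
        · exact Or.inr h.symm
      trans := by
        rintro u v w (rfl | h₁) (rfl | h₂)
        · exact Or.inl rfl
        · exact Or.inr h₂
        · exact Or.inr h₁
        · by_cases huw : u = w
          · exact Or.inl huw
          · exact Or.inr (h₁.trans h₂ huw) }

/-- The vertices of the twin graph: the twin-classes of `G`. -/
abbrev TwinVertex {V : Type*} (G : SimpleGraph V) : Type _ := Quotient (twinSetoid G)

/-- The class `v*` of a vertex `v`. -/
def star {V : Type*} (G : SimpleGraph V) (v : V) : TwinVertex G := Quotient.mk (twinSetoid G) v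

/-- The set of vertices of `G` that make up a vertex of the twin graph. -/
def twinClass {V : Type*} (G : SimpleGraph V) (a : TwinVertex G) : Set V :=
  {v : V | star G v = a}

/-- The twin graph `G*`: distinct classes are adjacent when they have adjacent representatives.
By `twinGraph_adj_star` below this does not depend on the representatives. -/
def twinGraph {V : Type*} (G : SimpleGraph V) : SimpleGraph (TwinVertex G) where
  Adj a b := a ≠ b ∧ ∃ v ∈ twinClass G a, ∃ w ∈ twinClass G b, G.Adj v w
  symm := ⟨by
    rintro a b ⟨hab, v, hv, w, hw, h⟩
    exact ⟨hab.symm, w, hw, v, hv, h.symm⟩⟩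
  loopless := ⟨fun a h => h.1 rfl⟩

theorem star_eq_star_iff {V : Type*} (G : SimpleGraph V) (v w : V) :
    star G v = star G w ↔ v = w ∨ Twins G v w :=
  Quotient.eq (r := twinSetoid G)

theorem adj_congr_left {V : Type*} {G : SimpleGraph V} {v v' w : V}
    (h : star G v = star G v') (hw : star G v ≠ star G w) : G.Adj v w ↔ G.Adj v' w := by
  rcases (star_eq_star_iff G v v').1 h with rfl | ht
  · rfl
  · refine ht.adj_iff ?_ ?_
    · rintro rfl; exact hw rfl
    · rintro rfl; exact hw h

/-- Distinct classes are adjacent in the twin graph if and only if their (arbitrary)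
representatives are adjacent in `G`. -/
theorem twinGraph_adj_star {V : Type*} (G : SimpleGraph V) (v w : V) :
    (twinGraph G).Adj (star G v) (star G w) ↔ star G v ≠ star G w ∧ G.Adj v w := by
  constructor
  · rintro ⟨hne, v', hv, w', hw, h⟩
    have hv' : star G v' = star G v := hv
    have hw' : star G w' = star G w := hw
    refine ⟨hne, ?_⟩
    have h₁ : G.Adj v w' := (adj_congr_left hv' (by rw [hv', hw']; exact hne)).1 h
    exact ((adj_congr_left hw' (by rw [hw']; exact hne.symm)).1 h₁.symm).symm
  · rintro ⟨hne, h⟩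
    exact ⟨hne, v, rfl, w, rfl, h⟩

/-- Type `(1)`: the class has exactly one vertex. -/
def Type1 {V : Type*} (G : SimpleGraph V) (a : TwinVertex G) : Prop :=
  (twinClass G a).ncard = 1

/-- Type `(K)`: the class has at least two vertices and induces a complete graph. -/
def TypeK {V : Type*} (G : SimpleGraph V) (a : TwinVertex G) : Prop :=
  2 ≤ (twinClass G a).ncard ∧ G.IsClique (twinClass G a)

/-- Type `(N)`: the class has at least two vertices and induces a graph without edges. -/
def TypeN {V : Type*} (G : SimpleGraph V) (a : TwinVertex G) : Prop :=
  2 ≤ (twinClass G a).ncard ∧ G.IsIndepSet (twinClass G a)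

/-- Type `(1K)`. -/
def Type1K {V : Type*} (G : SimpleGraph V) (a : TwinVertex G) : Prop :=
  Type1 G a ∨ TypeK G a

/-- Type `(1N)`. -/
def Type1N {V : Type*} (G : SimpleGraph V) (a : TwinVertex G) : Prop :=
  Type1 G a ∨ TypeN G a

/-- Type `(KN)`. -/
def TypeKN {V : Type*} (G : SimpleGraph V) (a : TwinVertex G) : Prop :=
  TypeK G a ∨ TypeN G a

/-- `α(G*)`: the number of vertices of the twin graph of type `(K)` or `(N)`. -/
noncomputable def alpha {V : Type*} (G : SimpleGraph V) : ℕ :=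
  {a : TwinVertex G | TypeKN G a}.ncard

/-- `a` is a leaf of the graph `H`, that is, it has degree one. -/
def IsLeaf {W : Type*} (H : SimpleGraph W) (a : W) : Prop :=
  (H.neighborSet a).ncard = 1

/-- The path `(u_0, …, u_D)`, with `u_i` written `some i`, together with one new vertex `none`
adjacent to exactly those `u_i` with `i ∈ S`. -/
def pathPlus (D : ℕ) (S : Set ℕ) : SimpleGraph (Option (Fin (D + 1))) where
  Adj
    | some i, some j => (SimpleGraph.pathGraph (D + 1)).Adj i j
    | some i, none => (i : ℕ) ∈ S
    | none, some j => (j : ℕ) ∈ S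
    | none, none => False
  symm := ⟨by
    rintro (_ | i) (_ | j) h
    · exact h
    · exact h
    · exact h
    · exact SimpleGraph.Adj.symm h⟩
  loopless := ⟨by
    rintro (_ | i) h
    · exact h
    · exact SimpleGraph.irrefl _ h⟩

/-- `P_{D+1,k}`: the path `(u_0, …, u_D)` and one more vertex, adjacent to `u_{k-1}`. -/
def pathPendant (D k : ℕ) : SimpleGraph (Option (Fin (D + 1))) :=
  pathPlus D {k - 1}

/-- `P'_{D+1,k}`: the path `(u_0, …, u_D)` and one more vertex, adjacent to `u_{k-1}` and `u_k`. -/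
def pathTriangle (D k : ℕ) : SimpleGraph (Option (Fin (D + 1))) :=
  pathPlus D {k - 1, k}

/-- The case of a path: `G* ≅ P_{D+1}` with one of the conditions (a)–(d). -/
def PathCase {V : Type*} (G : SimpleGraph V) (D : ℕ) : Prop :=
  Nonempty (twinGraph G ≃g SimpleGraph.pathGraph (D + 1)) ∧
    (alpha G ≤ 1 ∨
      (alpha G = 2 ∧ ∀ a b : TwinVertex G, a ≠ b → ¬ Type1 G a → ¬ Type1 G b →
        (twinGraph G).Adj a b ∧ (IsLeaf (twinGraph G) a → TypeK G a → TypeK G b)) ∨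
      (alpha G = 2 ∧ ∀ a b : TwinVertex G, a ≠ b → ¬ Type1 G a → ¬ Type1 G b →
        (twinGraph G).dist a b = 2 ∧ TypeN G a ∧ TypeN G b) ∨
      (alpha G = 3 ∧ ∃ a b c : TwinVertex G, b ≠ c ∧ (twinGraph G).Adj a b ∧
        (twinGraph G).Adj a c ∧ TypeKN G a ∧ TypeN G b ∧ TypeN G c))

/-- The case `G* ≅ P_{D+1,k}` for some `k ∈ [3, D-1]`: the vertex `c` of `G*` of degree three
is of any type, each neighbour of `c` is of type `(1N)`, and every other vertex is of type `(1)`. -/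
def PendantCase {V : Type*} (G : SimpleGraph V) (D : ℕ) : Prop :=
  ∃ k : ℕ, 3 ≤ k ∧ k ≤ D - 1 ∧ Nonempty (twinGraph G ≃g pathPendant D k) ∧
    ∃ c : TwinVertex G, ((twinGraph G).neighborSet c).ncard = 3 ∧
      (∀ a, (twinGraph G).Adj c a → Type1N G a) ∧
      ∀ a, a ≠ c → ¬ (twinGraph G).Adj c a → Type1 G a

/-- The case `G* ≅ P'_{D+1,k}` for some `k ∈ [2, D-1]`: the three vertices `x, y, z` in the cycle
of `G*` are of type `(1K)`, and every other vertex is of type `(1)`. -/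
def TriangleCase {V : Type*} (G : SimpleGraph V) (D : ℕ) : Prop :=
  ∃ k : ℕ, 2 ≤ k ∧ k ≤ D - 1 ∧ Nonempty (twinGraph G ≃g pathTriangle D k) ∧
    ∃ x y z : TwinVertex G, (twinGraph G).Adj x y ∧ (twinGraph G).Adj y z ∧
      (twinGraph G).Adj z x ∧ Type1K G x ∧ Type1K G y ∧ Type1K G z ∧
      ∀ a, a ≠ x → a ≠ y → a ≠ z → Type1 G a

end MetricDim

/-!
Write `Extremal G D` for the statement that no set `T` of `D + 1` vertices has a resolving
complement. In a connected graph a vertex outside of `T` resolves every pair that contains it, so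
this only asks which pairs within `T` are resolved from outside, and it is equivalent to
`β(G) = n - D` (`metricDimension_eq_iff_extremal`): a transversal of the distance layers of an end
of a diametral path, without that end, always has a resolving complement and has `D` elements.

The characterization of extremal graphs rests on `Extremal.eq_of_resolves`. Let `u` be an end of a
diametral path. If two vertices of one distance layer of `u` are resolved by a third vertex which is
not alone in its own layer, then a transversal of the layers avoiding the third vertex, enlarged by
the second vertex of the pair, is a set of `D + 1` vertices with a resolving complement. Hence in an
extremal graph all layers are cliques or independent sets, and consecutive layers are completely
joined, except that some vertices of a layer (the *deficient* ones) may miss the next layer if that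
consists of a single vertex. Since a deficient vertex and the vertex of a diametral path in the same
layer have different distances to the other end of that path, deficient vertices cannot occur in two
different layers (`Extremal.dist_eq_of_deficient`). So an extremal graph is a blow-up of a path
`(u_0, …, u_D)`, or of such a path with one additional vertex, adjacent to `u_{j-1}` and to `u_j`
(if the layer `j` of the deficient vertices is a clique) or only to `u_{j-1}` (if it is
independent); for small `j` the additional vertex is a twin of `u_0` or contradicts the diameter.

It remains to decide which blow-ups are extremal. The vertices of a set with a resolving complement
lie in distinct fibres. For a path, such a set of `D + 1` vertices is a transversal, and the pairs
of positions that may be unresolved outside of it are read off from the distances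
(`IsBlowUp.extremal_path_iff`). For the other two graphs the set misses exactly one fibre; if the
types are as stated, two vertices of the triangle, resp. two neighbours of the vertex of degree
three, have the same distance to that fibre (`IsBlowUp.extremal_triangle`,
`IsBlowUp.extremal_pendant`), and conversely the types follow from `Extremal.eq_of_resolves`,
applied to the distance layers of both ends of the path. The twin graph of a blow-up of a graph
without twins is that graph (`IsBlowUp.exists_iso`), which turns these conditions on fibres into
conditions on twin classes.
-/

namespace MetricDim

variable {V : Type*} {G : SimpleGraph V}

/-! ### Distances -/

theorem Adj.dist_le_succ (hG : G.Connected) {x y : V} (h : G.Adj x y) (u : V) :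
    G.dist u y ≤ G.dist u x + 1 := by
  have h₁ := hG.dist_triangle (u := u) (v := x) (w := y)
  rwa [SimpleGraph.dist_eq_one_iff_adj.2 h] at h₁

theorem exists_adj_dist_eq {u v : V} {m : ℕ} (h : G.dist u v = m + 1) :
    ∃ w, G.Adj w v ∧ G.dist u w = m := by
  have hr : G.Reachable v u := SimpleGraph.Reachable.of_dist_ne_zero
    (by rw [SimpleGraph.dist_comm, h]; exact Nat.succ_ne_zero m)
  obtain ⟨p, hp⟩ := hr.exists_walk_length_eq_dist
  rw [SimpleGraph.dist_comm, h] at hp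
  cases p with
  | nil => simp at hp
  | @cons _ w _ hvw p =>
    rw [SimpleGraph.Walk.length_cons, Nat.add_right_cancel_iff] at hp
    refine ⟨w, hvw.symm, le_antisymm ?_ ?_⟩
    · rw [SimpleGraph.dist_comm, ← hp]; exact SimpleGraph.dist_le p
    · have hw : G.Reachable u w := hr.symm.trans hvw.reachable
      have h₁ := hw.dist_triangle_left v
      rw [h, SimpleGraph.dist_eq_one_iff_adj.2 hvw.symm] at h₁
      omega

/-- Every distance up to `dist u v` is realized on a shortest path from `u` to `v`. -/
theorem exists_on_geodesic (hG : G.Connected) {u v : V} {D : ℕ} (h : G.dist u v = D) {i : ℕ}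
    (hi : i ≤ D) : ∃ w, G.dist u w = i ∧ G.dist w v = D - i := by
  induction hj : D - i generalizing i with
  | zero => exact ⟨v, by omega, by simp⟩
  | succ j ih =>
    obtain ⟨w, hw, hwv⟩ := ih (i := i + 1) (by omega) (by omega)
    obtain ⟨z, hz, hzu⟩ := exists_adj_dist_eq hw
    refine ⟨z, hzu, ?_⟩
    have h₁ := Adj.dist_le_succ hG hz.symm v
    have h₂ := hG.dist_triangle (u := u) (v := z) (w := v)
    rw [SimpleGraph.dist_comm, G.dist_comm (u := v)] at h₁
    omega

theorem dist_eq_two (hG : G.Connected) {x y z : V} (hne : x ≠ y) (hxy : ¬ G.Adj x y)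
    (hxz : G.Adj z x) (hzy : G.Adj z y) : G.dist x y = 2 := by
  have h₁ := Adj.dist_le_succ hG hzy x
  rw [SimpleGraph.dist_eq_one_iff_adj.2 hxz.symm] at h₁
  have h₂ := hG.one_lt_dist_of_ne_of_not_adj hne hxy
  omega

theorem twins_of_forall {u v : V} (hne : u ≠ v)
    (h : ∀ w, w ≠ u → w ≠ v → (G.Adj u w ↔ G.Adj v w)) : Twins G u v := by
  by_cases huv : G.Adj u v
  · refine Or.inl ⟨hne, Set.ext fun w => ?_⟩
    have := h w
    have := huv.symm
    simp only [Set.mem_insert_iff, SimpleGraph.mem_neighborSet]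
    grind
  · refine Or.inr ⟨hne, Set.ext fun w => ?_⟩
    have h₁ := h w
    have h₂ : ¬ G.Adj v u := fun h => huv h.symm
    simp only [SimpleGraph.mem_neighborSet]
    rcases eq_or_ne w u with rfl | hu
    · simp [h₂]
    · rcases eq_or_ne w v with rfl | hv
      · simp [huv]
      · exact h₁ hu hv

theorem Twins.dist_le (hG : G.Connected) {u v w : V} (h : Twins G u v) (hu : w ≠ u)
    (hv : w ≠ v) : G.dist u w ≤ G.dist v w := by
  obtain ⟨m, hm⟩ : ∃ m, G.dist w v = m + 1 :=
    Nat.exists_eq_succ_of_ne_zero (hG.pos_dist_of_ne hv).ne'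
  obtain ⟨z, hzv, hz⟩ := exists_adj_dist_eq hm
  rw [SimpleGraph.dist_comm, G.dist_comm (u := v), hm]
  rcases eq_or_ne z u with rfl | hzu
  · omega
  · have hz' := (h.adj_iff hzu hzv.ne).2 hzv.symm
    have := Adj.dist_le_succ hG hz'.symm w
    omega

/-- Twins have the same distance to every other vertex. -/
theorem Twins.dist_eq (hG : G.Connected) {u v w : V} (h : Twins G u v) (hu : w ≠ u)
    (hv : w ≠ v) : G.dist u w = G.dist v w :=
  le_antisymm (h.dist_le hG hu hv) (h.symm.dist_le hG hv hu)

/-! ### Sets of vertices whose complement is resolving -/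

/-- The complement of `T` resolves all pairs of vertices of `T`. In a connected graph this says
that the complement of `T` is a resolving set. -/
def OutsideResolved (G : SimpleGraph V) (T : Finset V) : Prop :=
  ∀ v ∈ T, ∀ w ∈ T, v ≠ w → ∃ x, x ∉ T ∧ Resolves G x v w

/-- No set of `D + 1` vertices has a resolving complement. For a connected graph of order `n` and
diameter `D` this is the equality `β(G) = n - D`. -/
def Extremal (G : SimpleGraph V) (D : ℕ) : Prop :=
  ∀ T : Finset V, T.card = D + 1 → ¬ OutsideResolved G T

theorem isResolvingSet_of_outsideResolved (hG : G.Connected) {T : Finset V} {S : Set V}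
    (hT : OutsideResolved G T) (hS : ∀ x, x ∉ T → x ∈ S) : IsResolvingSet G S := by
  intro v w hvw
  by_cases hv : v ∈ T
  · by_cases hw : w ∈ T
    · obtain ⟨x, hx, h⟩ := hT v hv w hw hvw
      exact ⟨x, hS x hx, h⟩
    · refine ⟨w, hS w hw, ?_⟩
      rw [Resolves, SimpleGraph.dist_self]
      exact (hG.pos_dist_of_ne hvw).ne'
  · refine ⟨v, hS v hv, ?_⟩
    rw [Resolves, SimpleGraph.dist_self]
    exact (hG.pos_dist_of_ne hvw.symm).ne

theorem metricDimension_le {S : Finset V} (hS : IsResolvingSet G (S : Set V)) :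
    metricDimension G ≤ S.card :=
  Nat.sInf_le ⟨S, rfl, hS⟩

/-- A transversal of the distance layers of an end of a diametral path, without that end, is
resolved by that end. -/
theorem metricDimension_add_le [Fintype V] (hG : G.Connected) {u v : V} {D : ℕ}
    (huv : G.dist u v = D) : metricDimension G + D ≤ Fintype.card V := by
  classical
  choose a ha using fun i : Fin D => exists_on_geodesic hG huv (i := i + 1) (by omega)
  have hinj : Function.Injective a := fun i j hij => by
    have h₁ := (ha i).1
    rw [hij, (ha j).1] at h₁
    exact Fin.ext (by omega)
  set T : Finset V := Finset.univ.image a with hT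
  have hcard : T.card = D := by
    rw [hT, Finset.card_image_of_injective _ hinj, Finset.card_univ, Fintype.card_fin]
  have hu : u ∉ T := by
    intro h
    obtain ⟨i, -, hi⟩ := Finset.mem_image.1 h
    have := (ha i).1
    rw [hi, SimpleGraph.dist_self] at this
    omega
  have hres : OutsideResolved G T := by
    intro x hx y hy hxy
    obtain ⟨i, -, rfl⟩ := Finset.mem_image.1 hx
    obtain ⟨j, -, rfl⟩ := Finset.mem_image.1 hy
    refine ⟨u, hu, ?_⟩
    rw [Resolves, SimpleGraph.dist_comm, (ha i).1, SimpleGraph.dist_comm, (ha j).1]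
    intro h
    exact hxy (congrArg a (Fin.ext (by omega)))
  have h₁ := metricDimension_le (S := Tᶜ)
    (isResolvingSet_of_outsideResolved hG hres (by simp))
  have h₂ := Finset.card_compl T
  have h₃ := Finset.card_le_univ T
  omega

theorem metricDimension_eq_iff_extremal [Fintype V] (hG : G.Connected) {u v : V} {D : ℕ}
    (huv : G.dist u v = D) :
    (metricDimension G : ℤ) = (Fintype.card V : ℤ) - (D : ℤ) ↔ Extremal G D := by
  classical
  have hle := metricDimension_add_le hG huv
  constructor
  · intro h T hT hres
    have h₁ := metricDimension_le (S := Tᶜ)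
      (isResolvingSet_of_outsideResolved hG hres (by simp))
    have h₂ := Finset.card_compl T
    have h₃ := Finset.card_le_univ T
    omega
  · intro h
    obtain ⟨S, hS, hres⟩ : ∃ S : Finset V, S.card = metricDimension G ∧
        IsResolvingSet G (S : Set V) := by
      refine Nat.sInf_mem (s := {m | ∃ S : Finset V, S.card = m ∧ IsResolvingSet G (S : Set V)})
        ⟨_, Finset.univ, rfl, ?_⟩
      exact isResolvingSet_of_outsideResolved hG (T := ∅) (by simp [OutsideResolved]) (by simp)
    by_contra hne
    have h₁ := Finset.card_compl S
    have h₂ := Finset.card_le_univ S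
    obtain ⟨T, hTS, hT⟩ := Finset.exists_subset_card_eq (s := Sᶜ) (n := D + 1) (by omega)
    refine h T hT fun x _ y _ hxy => ?_
    obtain ⟨z, hz, hzr⟩ := hres x y hxy
    exact ⟨z, fun hzT => Finset.mem_compl.1 (hTS hzT) hz, hzr⟩

/-- The rigidity of the distance layers of an end `u` of a diametral path: two vertices of the same
layer can be resolved by a third vertex only if that vertex is alone in its layer. Otherwise a
transversal of the layers that avoids the third vertex, enlarged by the second vertex of the pair,
has a resolving complement. -/
theorem Extremal.eq_of_resolves {D : ℕ} (h : Extremal G D) (hG : G.Connected) {u v : V}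
    (huv : G.dist u v = D) {p q x y : V} (hpq : p ≠ q) (hd : G.dist u p = G.dist u q)
    (hxp : x ≠ p) (hxq : x ≠ q) (hres : G.dist p x ≠ G.dist q x)
    (hxy : G.dist u y = G.dist u x) : y = x := by
  classical
  by_contra hne
  have hp0 : 0 < G.dist u p := by
    rcases Nat.eq_zero_or_pos (G.dist u p) with h0 | h0
    · exact absurd ((hG.dist_eq_zero_iff.1 h0).symm.trans (hG.dist_eq_zero_iff.1 (hd ▸ h0))) hpq
    · exact h0
  have hex : ∀ i : Fin D, ∃ w, G.dist u w = i + 1 ∧ w ≠ x ∧ (G.dist u p = i + 1 → w = p) := by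
    intro i
    by_cases hi : G.dist u p = i + 1
    · exact ⟨p, hi, hxp.symm, fun _ => rfl⟩
    · by_cases hi' : G.dist u x = i + 1
      · exact ⟨y, by omega, hne, fun h => absurd h hi⟩
      · obtain ⟨w, hw, -⟩ := exists_on_geodesic hG huv (i := i + 1) (by omega)
        exact ⟨w, hw, fun h => hi' (h ▸ hw), fun h => absurd h hi⟩
  choose a ha hax hap using hex
  have hinj : Function.Injective a := fun i j hij => by
    have h₁ := ha i
    rw [hij, ha j] at h₁
    exact Fin.ext (by omega)
  have hq : q ∉ Finset.univ.image a := by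
    intro hq
    obtain ⟨i, -, hi⟩ := Finset.mem_image.1 hq
    have h₁ := ha i
    rw [hi, ← hd] at h₁
    exact hpq ((hap i h₁).symm.trans hi)
  -- in `insert q (range a)` the only pair in a common layer is `p, q`
  have key : ∀ i, G.dist (a i) u = G.dist q u → a i = p := fun i hi => by
    rw [SimpleGraph.dist_comm, G.dist_comm (u := q), ← hd, ha i] at hi
    exact hap i hi.symm
  have huT : u ∉ insert q (Finset.univ.image a) := by
    simp only [Finset.mem_insert, Finset.mem_image, Finset.mem_univ, true_and, not_or, not_exists]
    refine ⟨fun h => ?_, fun i h => ?_⟩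
    · rw [hd, ← h, SimpleGraph.dist_self] at hp0
      omega
    · have := ha i
      rw [h, SimpleGraph.dist_self] at this
      omega
  have hxT : x ∉ insert q (Finset.univ.image a) := by
    simp only [Finset.mem_insert, Finset.mem_image, Finset.mem_univ, true_and, not_or, not_exists]
    exact ⟨hxq, hax⟩
  refine h (insert q (Finset.univ.image a)) ?_ ?_
  · rw [Finset.card_insert_of_notMem hq, Finset.card_image_of_injective _ hinj, Finset.card_univ,
      Fintype.card_fin]
  · intro s hs t ht hst
    by_cases hu : G.dist s u = G.dist t u
    · refine ⟨x, hxT, ?_⟩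
      rcases Finset.mem_insert.1 hs with rfl | hs' <;>
        rcases Finset.mem_insert.1 ht with rfl | ht'
      · exact absurd rfl hst
      · obtain ⟨i, -, rfl⟩ := Finset.mem_image.1 ht'
        rw [key i hu.symm]
        exact hres.symm
      · obtain ⟨i, -, rfl⟩ := Finset.mem_image.1 hs'
        rw [key i hu]
        exact hres
      · obtain ⟨i, -, rfl⟩ := Finset.mem_image.1 hs'
        obtain ⟨j, -, rfl⟩ := Finset.mem_image.1 ht'
        rw [SimpleGraph.dist_comm, ha, SimpleGraph.dist_comm, ha] at hu
        exact absurd (congrArg a (Fin.ext (by omega))) hst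
    · exact ⟨u, huT, hu⟩

end MetricDim

namespace MetricDim

variable {V W : Type*} {G : SimpleGraph V} {H : SimpleGraph W} {f : V → W}

/-! ### Blow-ups -/

/-- `G` is obtained from `H` by replacing each vertex `a` by the nonempty fibre `f ⁻¹' {a}`, which
is a clique or an independent set, and each edge by a complete bipartite graph. -/
structure IsBlowUp (G : SimpleGraph V) (H : SimpleGraph W) (f : V → W) : Prop where
  surj : Function.Surjective f
  adj_iff : ∀ x y, f x ≠ f y → (G.Adj x y ↔ H.Adj (f x) (f y))
  homogeneous : ∀ a, G.IsClique (f ⁻¹' {a}) ∨ G.IsIndepSet (f ⁻¹' {a})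

/-- `H` has no twins. -/
def TwinFree (H : SimpleGraph W) : Prop :=
  ∀ a b, a ≠ b → ∃ c, c ≠ a ∧ c ≠ b ∧ ¬ (H.Adj a c ↔ H.Adj b c)

namespace IsBlowUp

theorem adj_of_adj (h : IsBlowUp G H f) {x y : V} (hxy : H.Adj (f x) (f y)) : G.Adj x y :=
  (h.adj_iff x y hxy.ne).2 hxy

theorem eq_or_adj (h : IsBlowUp G H f) {x y : V} (hxy : G.Adj x y) :
    f x = f y ∨ H.Adj (f x) (f y) := by
  by_cases hf : f x = f y
  · exact Or.inl hf
  · exact Or.inr ((h.adj_iff x y hf).1 hxy)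

/-- Within a fibre, adjacency of one pair of distinct vertices decides that of all pairs. -/
theorem adj_iff_adj (h : IsBlowUp G H f) {x y x' y' : V} (hxy : f x = f y) (hx : f x' = f x)
    (hy : f y' = f x) (hne : x ≠ y) (hne' : x' ≠ y') : G.Adj x y ↔ G.Adj x' y' := by
  rcases h.homogeneous (f x) with hc | hi
  · exact ⟨fun _ => hc (by simpa using hx) (by simpa using hy) hne',
      fun _ => hc (by simp) (by simpa using hxy.symm) hne⟩
  · exact ⟨fun hadj => absurd hadj (hi (by simp) (by simpa using hxy.symm) hne),
      fun hadj => absurd hadj (hi (by simpa using hx) (by simpa using hy) hne')⟩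

theorem twins (h : IsBlowUp G H f) {x y : V} (hf : f x = f y) (hne : x ≠ y) : Twins G x y := by
  refine twins_of_forall hne fun w hx hy => ?_
  by_cases hw : f w = f x
  · exact (h.adj_iff_adj hw.symm hf.symm hw hx.symm hy.symm)
  · rw [h.adj_iff x w (Ne.symm hw), h.adj_iff y w (fun h => hw (h.symm.trans hf.symm)), hf]

theorem star_eq_iff (h : IsBlowUp G H f) (hH : TwinFree H) {x y : V} :
    star G x = star G y ↔ f x = f y := by
  rw [star_eq_star_iff]
  constructor
  · rintro (rfl | ht)
    · rfl
    · by_contra hne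
      obtain ⟨c, hca, hcb, hc⟩ := hH _ _ hne
      obtain ⟨z, rfl⟩ := h.surj c
      refine hc ?_
      rw [← h.adj_iff x z hca.symm, ← h.adj_iff y z hcb.symm]
      exact ht.adj_iff (fun h => hca (h ▸ rfl)) (fun h => hcb (h ▸ rfl))
  · intro hf
    by_cases hne : x = y
    · exact Or.inl hne
    · exact Or.inr (h.twins hf hne)

/-- The twin graph of a blow-up of a twin-free graph is that graph. -/
theorem exists_iso (h : IsBlowUp G H f) (hH : TwinFree H) :
    ∃ e : twinGraph G ≃g H, ∀ x, e (star G x) = f x := by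
  let g : TwinVertex G → W := Quotient.lift f fun x y hxy =>
    (h.star_eq_iff hH).1 (Quotient.sound hxy)
  have hg : ∀ x, g (star G x) = f x := fun _ => rfl
  have hbij : Function.Bijective g := by
    constructor
    · intro a b
      obtain ⟨x, rfl⟩ := Quotient.exists_rep a
      obtain ⟨y, rfl⟩ := Quotient.exists_rep b
      exact (h.star_eq_iff hH).2
    · intro w
      obtain ⟨x, rfl⟩ := h.surj w
      exact ⟨star G x, rfl⟩
  refine ⟨⟨Equiv.ofBijective g hbij, ?_⟩, hg⟩
  intro a b
  obtain ⟨x, rfl⟩ := Quotient.exists_rep a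
  obtain ⟨y, rfl⟩ := Quotient.exists_rep b
  change H.Adj (f x) (f y) ↔ (twinGraph G).Adj (star G x) (star G y)
  rw [twinGraph_adj_star, Ne, h.star_eq_iff hH]
  exact ⟨fun hadj => ⟨hadj.ne, h.adj_of_adj hadj⟩, fun hadj => (h.adj_iff x y hadj.1).1 hadj.2⟩

/-- A set with a resolving complement has at most one vertex in each fibre, because twins are
resolved only by themselves. -/
theorem injOn_of_outsideResolved (h : IsBlowUp G H f) (hG : G.Connected) {T : Finset V}
    (hT : OutsideResolved G T) : Set.InjOn f T := by
  intro x hx y hy hf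
  by_contra hne
  obtain ⟨z, hz, hr⟩ := hT x hx y hy hne
  exact hr ((h.twins hf hne).dist_eq hG (fun h => hz (h ▸ hx)) (fun h => hz (h ▸ hy)))

/-- Distances from `s` are the differences of a level function `L` along which neighbours differ by
at most one, if one can descend from each higher fibre to the fibre of `s`. -/
theorem dist_eq_of_level (h : IsBlowUp G H f) (hG : G.Connected) (L : W → ℕ)
    (hL : ∀ a b, H.Adj a b → L b ≤ L a + 1) (s : V)
    (hdown : ∀ b, L (f s) < L b → ∃ a, H.Adj a b ∧ L a + 1 = L b ∧ (L a = L (f s) → a = f s))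
    (y : V) (hy : L (f s) < L (f y)) : G.dist s y = L (f y) - L (f s) := by
  have hlow : ∀ (m : ℕ) (y : V), G.dist s y = m → L (f y) ≤ L (f s) + m := by
    intro m
    induction m with
    | zero =>
      intro y hy
      rw [hG.dist_eq_zero_iff.1 hy]
      rfl
    | succ m ih =>
      intro y hy
      obtain ⟨z, hzy, hz⟩ := exists_adj_dist_eq hy
      have h₁ := ih z hz
      rcases h.eq_or_adj hzy with h₂ | h₂
      · rw [← h₂]; omega
      · have := hL _ _ h₂; omega
  have hup : ∀ (m : ℕ) (y : V), L (f y) = L (f s) + m + 1 → G.dist s y ≤ m + 1 := by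
    intro m
    induction m with
    | zero =>
      intro y hy
      obtain ⟨a, hab, ha, has⟩ := hdown (f y) (by omega)
      rw [has (by omega)] at hab
      rw [SimpleGraph.dist_eq_one_iff_adj.2 (h.adj_of_adj hab)]
    | succ m ih =>
      intro y hy
      obtain ⟨a, hab, ha, -⟩ := hdown (f y) (by omega)
      obtain ⟨z, rfl⟩ := h.surj a
      have h₁ := ih z (by omega)
      have h₂ := Adj.dist_le_succ hG (h.adj_of_adj hab) s
      omega
  have h₁ := hlow _ y rfl
  have h₂ := hup (L (f y) - L (f s) - 1) y (by omega)
  omega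

end IsBlowUp

/-- Twin classes are cliques or independent sets. -/
theorem twinClass_homogeneous (G : SimpleGraph V) (a : TwinVertex G) :
    G.IsClique (twinClass G a) ∨ G.IsIndepSet (twinClass G a) := by
  have ht : ∀ {x y}, x ∈ twinClass G a → y ∈ twinClass G a → x ≠ y → Twins G x y := by
    intro x y hx hy hne
    have hxy : star G x = star G y := Eq.trans hx (Eq.symm hy)
    exact ((star_eq_star_iff G x y).1 hxy).resolve_left hne
  by_contra! hcon
  obtain ⟨hc, hi⟩ := hcon
  rw [SimpleGraph.isIndepSet_iff, Set.Pairwise] at hi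
  push Not at hi
  obtain ⟨u, hu, v, hv, huv, hadj⟩ := hi
  have hu' : ∀ x ∈ twinClass G a, x ≠ u → G.Adj u x := by
    intro x hx hxu
    rcases eq_or_ne x v with rfl | hxv
    · exact hadj
    · exact (((ht hv hx hxv.symm).adj_iff huv hxu.symm).1 hadj.symm).symm
  refine hc fun x hx y hy hxy => ?_
  rcases eq_or_ne x u with rfl | hxu
  · exact hu' y hy hxy.symm
  · rcases eq_or_ne y u with rfl | hyu
    · exact (hu' x hx hxu).symm
    · exact ((ht hu hx hxu.symm).adj_iff hyu hxy.symm).1 (hu' y hy hyu)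

theorem isBlowUp_of_iso (e : twinGraph G ≃g H) : IsBlowUp G H fun x => e (star G x) where
  surj w := by
    obtain ⟨x, hx⟩ := Quotient.exists_rep (e.symm w)
    exact ⟨x, by change e (Quotient.mk _ x) = w; rw [hx]; simp⟩
  adj_iff x y hne := by
    have hne' : star G x ≠ star G y := fun h => hne (by rw [h])
    rw [e.map_adj_iff, twinGraph_adj_star]
    simp [hne']
  homogeneous a := by
    have : (fun x => e (star G x)) ⁻¹' {a} = twinClass G (e.symm a) := by
      ext x
      change e (star G x) = a ↔ star G x = e.symm a
      exact e.toEquiv.eq_symm_apply.symm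
    rw [this]
    exact twinClass_homogeneous G _

/-! ### Types of twin classes in terms of pairs -/

variable [Finite V]

theorem twinClass_ncard_pos (a : TwinVertex G) : 0 < (twinClass G a).ncard := by
  obtain ⟨x, hx⟩ := Quotient.exists_rep a
  exact (Set.ncard_pos).2 ⟨x, hx⟩

theorem type1_iff (a : TwinVertex G) :
    Type1 G a ↔ ∀ x y, star G x = a → star G y = a → x = y := by
  have h := twinClass_ncard_pos a
  rw [Type1, show (twinClass G a).ncard = 1 ↔ (twinClass G a).ncard ≤ 1 by omega,
    Set.ncard_le_one_iff]
  exact ⟨fun h x y hx hy => h hx hy, fun h x y hx hy => h x y hx hy⟩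

theorem not_type1_iff (a : TwinVertex G) : ¬ Type1 G a ↔ 2 ≤ (twinClass G a).ncard := by
  have h := twinClass_ncard_pos a
  rw [Type1]
  omega

theorem typeK_iff (a : TwinVertex G) :
    TypeK G a ↔ ∃ x y, x ≠ y ∧ star G x = a ∧ star G y = a ∧ G.Adj x y := by
  rw [TypeK, ← not_type1_iff, type1_iff]
  push Not
  constructor
  · rintro ⟨⟨x, y, hx, hy, hne⟩, hc⟩
    exact ⟨x, y, hne, hx, hy, hc hx hy hne⟩
  · rintro ⟨x, y, hne, hx, hy, hadj⟩
    refine ⟨⟨x, y, hx, hy, hne⟩, (twinClass_homogeneous G a).resolve_right fun hi => ?_⟩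
    exact hi hx hy hne hadj

theorem typeN_iff (a : TwinVertex G) :
    TypeN G a ↔ ∃ x y, x ≠ y ∧ star G x = a ∧ star G y = a ∧ ¬ G.Adj x y := by
  rw [TypeN, ← not_type1_iff, type1_iff]
  push Not
  constructor
  · rintro ⟨⟨x, y, hx, hy, hne⟩, hc⟩
    exact ⟨x, y, hne, hx, hy, hc hx hy hne⟩
  · rintro ⟨x, y, hne, hx, hy, hadj⟩
    refine ⟨⟨x, y, hx, hy, hne⟩, (twinClass_homogeneous G a).resolve_left fun hi => ?_⟩
    exact hadj (hi hx hy hne)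

theorem typeKN_iff (a : TwinVertex G) : TypeKN G a ↔ ¬ Type1 G a := by
  rw [TypeKN, TypeK, TypeN, ← and_or_left, not_type1_iff]
  exact and_iff_left (twinClass_homogeneous G a)

theorem TypeK.not_typeN {a : TwinVertex G} (h : TypeK G a) : ¬ TypeN G a := by
  intro h'
  obtain ⟨x, y, hne, hx, hy, hadj⟩ := (typeK_iff a).1 h
  exact h'.2 hx hy hne hadj

theorem type1N_iff (a : TwinVertex G) :
    Type1N G a ↔ ∀ x y, x ≠ y → star G x = a → star G y = a → ¬ G.Adj x y := by
  have h₁ := typeKN_iff a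
  have h₂ := typeK_iff a
  have h₃ : TypeK G a → ¬ TypeN G a := TypeK.not_typeN
  have h₄ : TypeN G a → ¬ Type1 G a := fun h => h₁.1 (Or.inr h)
  have h₅ : TypeK G a → ¬ Type1 G a := fun h => h₁.1 (Or.inl h)
  rw [TypeKN] at h₁
  rw [Type1N, show (Type1 G a ∨ TypeN G a) ↔ ¬ TypeK G a by tauto, h₂]
  grind

theorem type1K_iff (a : TwinVertex G) :
    Type1K G a ↔ ∀ x y, x ≠ y → star G x = a → star G y = a → G.Adj x y := by
  have h₁ := typeKN_iff a
  have h₂ := typeN_iff a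
  have h₃ : TypeK G a → ¬ TypeN G a := TypeK.not_typeN
  have h₄ : TypeN G a → ¬ Type1 G a := fun h => h₁.1 (Or.inr h)
  rw [TypeKN] at h₁
  rw [Type1K, show (Type1 G a ∨ TypeK G a) ↔ ¬ TypeN G a by tauto, h₂]
  grind

end MetricDim

namespace MetricDim

variable {V : Type*} {G : SimpleGraph V}

/-! ### Blow-ups of paths -/

theorem twinFree_pathGraph {D : ℕ} (hD : 3 ≤ D) : TwinFree (SimpleGraph.pathGraph (D + 1)) := by
  have key : ∀ a b : Fin (D + 1), a < b → ∃ c, c ≠ a ∧ c ≠ b ∧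
      ¬ ((SimpleGraph.pathGraph (D + 1)).Adj a c ↔ (SimpleGraph.pathGraph (D + 1)).Adj b c) := by
    intro a b hab
    simp only [SimpleGraph.pathGraph_adj, Ne, Fin.ext_iff]
    have hab' : (a : ℕ) < b := hab
    have hb := b.isLt
    rcases Nat.lt_or_ge b D with h | h
    · exact ⟨⟨b + 1, by omega⟩, by dsimp only; omega⟩
    · rcases Nat.eq_zero_or_pos a with h0 | h0
      · exact ⟨⟨1, by omega⟩, by dsimp only; omega⟩
      · exact ⟨⟨a - 1, by omega⟩, by dsimp only; omega⟩
  intro a b hne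
  rcases lt_or_gt_of_ne hne with h | h
  · exact key a b h
  · obtain ⟨c, h₁, h₂, h₃⟩ := key b a h
    exact ⟨c, h₂, h₁, fun h => h₃ h.symm⟩

namespace IsBlowUp

/-- A set of as many vertices as there are fibres whose complement is resolving is a transversal of
the fibres. -/
theorem exists_mem_of_card {W : Type*} [Fintype W] {H : SimpleGraph W} {f : V → W}
    (h : IsBlowUp G H f) (hG : G.Connected) {T : Finset V} (hT : OutsideResolved G T)
    (hcard : T.card = Fintype.card W) (a : W) : ∃ t ∈ T, f t = a := by
  classical
  have h₁ := Finset.card_image_of_injOn (h.injOn_of_outsideResolved hG hT)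
  have h₂ := (Finset.card_eq_iff_eq_univ _).1 (h₁.trans hcard)
  exact Finset.mem_image.1 (h₂ ▸ Finset.mem_univ a)

variable {D : ℕ} {f : V → Fin (D + 1)}

theorem path_adj (h : IsBlowUp G (SimpleGraph.pathGraph (D + 1)) f) {x y : V}
    (hxy : (f x : ℕ) + 1 = f y ∨ (f y : ℕ) + 1 = f x) : G.Adj x y :=
  h.adj_of_adj (SimpleGraph.pathGraph_adj.2 hxy)

theorem path_dist (h : IsBlowUp G (SimpleGraph.pathGraph (D + 1)) f) (hG : G.Connected) {x y : V}
    (hxy : (f x : ℕ) < f y) : G.dist x y = f y - f x := by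
  refine h.dist_eq_of_level hG (fun i => (i : ℕ)) ?_ x ?_ y hxy
  · intro a b hab
    rw [SimpleGraph.pathGraph_adj] at hab
    omega
  · intro b hb
    refine ⟨⟨b - 1, by omega⟩, ?_, ?_, fun h => Fin.ext h⟩
    · rw [SimpleGraph.pathGraph_adj]
      change (b : ℕ) - 1 + 1 = b ∨ _
      omega
    · change (b : ℕ) - 1 + 1 = b
      omega

theorem path_dist_fibre (h : IsBlowUp G (SimpleGraph.pathGraph (D + 1)) f) (hG : G.Connected)
    (hD : 1 ≤ D) {x y : V} (hf : f x = f y) (hne : x ≠ y) (hxy : ¬ G.Adj x y) :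
    G.dist x y = 2 := by
  have hlt := (f x).isLt
  obtain ⟨z, hz⟩ : ∃ z, (f z : ℕ) + 1 = f x ∨ (f x : ℕ) + 1 = f z := by
    rcases Nat.eq_zero_or_pos (f x) with h0 | h0
    · obtain ⟨z, hz⟩ := h.surj ⟨1, by omega⟩
      exact ⟨z, Or.inr (by rw [hz, h0])⟩
    · obtain ⟨z, hz⟩ := h.surj ⟨f x - 1, by omega⟩
      exact ⟨z, Or.inl (by rw [hz]; dsimp only; omega)⟩
  exact dist_eq_two hG hne hxy (h.path_adj hz) (h.path_adj (hf ▸ hz))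

/-- In an extremal blow-up of a path, some pair `i < j` of positions is unresolved outside of a
given transversal. This restricts the positions and types of all nontrivial fibres. -/
theorem exists_unresolved (h : IsBlowUp G (SimpleGraph.pathGraph (D + 1)) f) (hG : G.Connected)
    (hD : 1 ≤ D) (hE : Extremal G D) :
    ∃ i j : ℕ, i < j ∧ j ≤ D ∧ ∀ x y, x ≠ y → f x = f y →
      (((f x : ℕ) = i ∨ (f x : ℕ) = j) ∧ (G.Adj x y ∧ j = i + 1 ∨ ¬ G.Adj x y ∧ j = i + 2)) ∨
      (i < f x ∧ f x < j ∧ 2 * (f x : ℕ) = i + j) := by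
  classical
  choose t ht using h.surj
  have hinj : Function.Injective t := fun i j hij => by rw [← ht i, hij, ht]
  have hcard : (Finset.univ.image t).card = D + 1 := by
    rw [Finset.card_image_of_injective _ hinj, Finset.card_univ, Fintype.card_fin]
  have hnot := hE _ hcard
  obtain ⟨i, j, hij, hun⟩ : ∃ i j : Fin (D + 1), i < j ∧
      ∀ s, s ≠ t (f s) → G.dist (t i) s = G.dist (t j) s := by
    by_contra! hcon
    refine hnot fun v hv w hw hne => ?_
    obtain ⟨i, -, rfl⟩ := Finset.mem_image.1 hv
    obtain ⟨j, -, rfl⟩ := Finset.mem_image.1 hw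
    have hout : ∀ s, s ≠ t (f s) → s ∉ Finset.univ.image t := by
      intro s hs hmem
      obtain ⟨l, -, rfl⟩ := Finset.mem_image.1 hmem
      rw [ht] at hs
      exact hs rfl
    rcases lt_or_gt_of_ne (fun h => hne (congrArg t h) : i ≠ j) with hlt | hlt
    · obtain ⟨s, hs, hr⟩ := hcon i j hlt
      exact ⟨s, hout s hs, hr⟩
    · obtain ⟨s, hs, hr⟩ := hcon j i hlt
      exact ⟨s, hout s hs, hr.symm⟩
  have hij' : (i : ℕ) < j := hij
  refine ⟨i, j, hij', by omega, fun x y hne hf => ?_⟩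
  -- one vertex of the pair lies outside of the transversal
  obtain ⟨s, hs, hsf, hadj⟩ : ∃ s, s ≠ t (f s) ∧ f s = f x ∧
      (G.Adj (t (f s)) s ↔ G.Adj x y) := by
    obtain ⟨s, hs, hsf⟩ : ∃ s, s ≠ t (f s) ∧ f s = f x := by
      by_cases hx : x = t (f x)
      · refine ⟨y, fun hy => hne ?_, hf.symm⟩
        rw [hx, hf]
        exact hy.symm
      · exact ⟨x, hx, rfl⟩
    exact ⟨s, hs, hsf, h.adj_iff_adj (by rw [ht]) (by rw [ht, hsf]) (by rw [ht, hsf, hf])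
      hs.symm hne⟩
  have hr := hun s hs
  have hfib : G.Adj x y ∧ G.dist (t (f s)) s = 1 ∨ ¬ G.Adj x y ∧ G.dist (t (f s)) s = 2 := by
    rw [← hadj]
    by_cases ha : G.Adj (t (f s)) s
    · exact Or.inl ⟨ha, SimpleGraph.dist_eq_one_iff_adj.2 ha⟩
    · exact Or.inr ⟨ha, h.path_dist_fibre hG hD (by rw [ht]) hs.symm ha⟩
  have hlt : ∀ a : Fin (D + 1), (a : ℕ) < f s → G.dist (t a) s = f s - a := fun a ha => by
    have := h.path_dist hG (x := t a) (y := s) (by rwa [ht])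
    rwa [ht] at this
  have hgt : ∀ a : Fin (D + 1), (f s : ℕ) < a → G.dist (t a) s = a - f s := fun a ha => by
    have := h.path_dist hG (x := s) (y := t a) (by rwa [ht])
    rwa [ht, SimpleGraph.dist_comm] at this
  rw [← hsf]
  rcases lt_trichotomy (f s : ℕ) i with hi | hi | hi
  · rw [hgt i hi, hgt j (hi.trans hij')] at hr
    omega
  · rw [← Fin.ext hi, hgt j (by omega)] at hr
    exact Or.inl ⟨Or.inl hi, hfib.imp (fun h => ⟨h.1, by omega⟩) fun h => ⟨h.1, by omega⟩⟩
  · rw [hlt i hi] at hr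
    rcases lt_trichotomy (f s : ℕ) j with hj | hj | hj
    · rw [hgt j hj] at hr
      right
      omega
    · rw [← Fin.ext hj] at hr
      exact Or.inl ⟨Or.inr hj, hfib.imp (fun h => ⟨h.1, by omega⟩) fun h => ⟨h.1, by omega⟩⟩
    · rw [hlt j hj] at hr
      omega

/-- A blow-up of a path is extremal if and only if either all nontrivial fibres are cliques over two
consecutive vertices, or all of them lie over three consecutive vertices, where only the one in the
middle may be a clique. In these cases the two resp. the two outer vertices of such a window give
the unresolved pair of every transversal. -/
theorem extremal_path_iff (h : IsBlowUp G (SimpleGraph.pathGraph (D + 1)) f) (hG : G.Connected)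
    (hD : 1 ≤ D) : Extremal G D ↔
      (∃ i : ℕ, i + 1 ≤ D ∧ ∀ x y, x ≠ y → f x = f y →
        ((f x : ℕ) = i ∨ (f x : ℕ) = i + 1) ∧ G.Adj x y) ∨
      (∃ i : ℕ, 1 ≤ i ∧ i + 1 ≤ D ∧ ∀ x y, x ≠ y → f x = f y →
        ((f x : ℕ) + 1 = i ∨ (f x : ℕ) = i ∨ (f x : ℕ) = i + 1) ∧
          ((f x : ℕ) ≠ i → ¬ G.Adj x y)) := by
  constructor
  · intro hE
    obtain ⟨i, j, hij, hj, hun⟩ := h.exists_unresolved hG hD hE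
    by_cases h₁ : j = i + 1
    · refine Or.inl ⟨i, by omega, fun x y hne hf => ?_⟩
      rcases hun x y hne hf with ⟨h₂, h₃ | h₃⟩ | h₂
      · exact ⟨by omega, h₃.1⟩
      · omega
      · omega
    -- the middle of `i` and `j`, rounded down
    · refine Or.inr ⟨(i + j) / 2, by omega, by omega, fun x y hne hf => ?_⟩
      rcases hun x y hne hf with ⟨h₂, h₃ | h₃⟩ | h₂
      · omega
      · exact ⟨by omega, fun _ => h₃.1⟩
      · exact ⟨by omega, fun h₃ => absurd (by omega) h₃⟩
  · rintro (⟨i, hi, hA⟩ | ⟨i, hi₁, hi, hB⟩) T hcard hT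
    · have hmem := h.exists_mem_of_card hG hT (by simpa using hcard)
      obtain ⟨p, hp, hfp⟩ := hmem ⟨i, by omega⟩
      obtain ⟨q, hq, hfq⟩ := hmem ⟨i + 1, by omega⟩
      have hpq : p ≠ q := fun hpq => by simp [hpq, hfq] at hfp
      obtain ⟨x, hx, hr⟩ := hT p hp q hq hpq
      obtain ⟨y, hy, hfy⟩ := hmem (f x)
      have hA' := hA x y (fun h => hx (h ▸ hy)) hfy.symm
      have hone : ∀ z ∈ T, ((f z : ℕ) = i ∨ (f z : ℕ) = i + 1) → G.dist z x = 1 := by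
        intro z hz hfz
        rw [SimpleGraph.dist_eq_one_iff_adj]
        by_cases hzx : f z = f x
        · exact (hA z x (fun h => hx (h ▸ hz)) hzx).2
        · refine h.path_adj ?_
          rw [Fin.ext_iff] at hzx
          omega
      exact hr ((hone p hp (by simp [hfp])).trans (hone q hq (by simp [hfq])).symm)
    · have hmem := h.exists_mem_of_card hG hT (by simpa using hcard)
      obtain ⟨p, hp, hfp⟩ := hmem ⟨i - 1, by omega⟩
      obtain ⟨q, hq, hfq⟩ := hmem ⟨i + 1, by omega⟩
      obtain ⟨m, -, hfm⟩ := hmem ⟨i, by omega⟩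
      rw [Fin.ext_iff] at hfp hfq hfm
      dsimp only at hfp hfq hfm
      have hpq : p ≠ q := fun hpq => by rw [hpq] at hfp; omega
      obtain ⟨x, hx, hr⟩ := hT p hp q hq hpq
      obtain ⟨y, hy, hfy⟩ := hmem (f x)
      have hB' := hB x y (fun h => hx (h ▸ hy)) hfy.symm
      by_cases hxi : (f x : ℕ) = i
      · refine hr ?_
        rw [SimpleGraph.dist_eq_one_iff_adj.2 (h.path_adj (by omega)),
          SimpleGraph.dist_eq_one_iff_adj.2 (h.path_adj (by omega))]
      · have htwo : ∀ z ∈ T, ((f z : ℕ) + 1 = i ∨ (f z : ℕ) = i + 1) → G.dist z x = 2 := by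
          intro z hz hfz
          have hzx : z ≠ x := fun h => hx (h ▸ hz)
          refine dist_eq_two hG hzx ?_ (h.path_adj (x := m) (by omega)) (h.path_adj (by omega))
          by_cases hf : f z = f x
          · exact (hB z x hzx hf).2 (by omega)
          · rw [h.adj_iff z x hf, SimpleGraph.pathGraph_adj]
            omega
        exact hr ((htwo p hp (by omega)).trans (htwo q hq (by omega)).symm)

end IsBlowUp

/-- The translation of the description of extremal blow-ups of paths into the list of types that
defines `PathCase`. -/
theorem pathCase_types_iff [Finite V] {D : ℕ} (hD : 3 ≤ D)
    (e : twinGraph G ≃g SimpleGraph.pathGraph (D + 1)) :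
    (alpha G ≤ 1 ∨
      (alpha G = 2 ∧ ∀ a b : TwinVertex G, a ≠ b → ¬ Type1 G a → ¬ Type1 G b →
        (twinGraph G).Adj a b ∧ (IsLeaf (twinGraph G) a → TypeK G a → TypeK G b)) ∨
      (alpha G = 2 ∧ ∀ a b : TwinVertex G, a ≠ b → ¬ Type1 G a → ¬ Type1 G b →
        (twinGraph G).dist a b = 2 ∧ TypeN G a ∧ TypeN G b) ∨
      (alpha G = 3 ∧ ∃ a b c : TwinVertex G, b ≠ c ∧ (twinGraph G).Adj a b ∧
        (twinGraph G).Adj a c ∧ TypeKN G a ∧ TypeN G b ∧ TypeN G c)) ↔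
    ((∃ i : ℕ, i + 1 ≤ D ∧ ∀ a, ¬ Type1 G a →
        ((e a : ℕ) = i ∨ (e a : ℕ) = i + 1) ∧ TypeK G a) ∨
      (∃ i : ℕ, 1 ≤ i ∧ i + 1 ≤ D ∧ ∀ a, ¬ Type1 G a →
        ((e a : ℕ) + 1 = i ∨ (e a : ℕ) = i ∨ (e a : ℕ) = i + 1) ∧
          ((e a : ℕ) ≠ i → TypeN G a))) := by
  have hadj : ∀ a b, (twinGraph G).Adj a b ↔ (e a : ℕ) + 1 = e b ∨ (e b : ℕ) + 1 = e a :=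
    fun a b => by rw [← e.map_adj_iff, SimpleGraph.pathGraph_adj]
  have hinj : ∀ a b, (e a : ℕ) = e b → a = b := fun a b hab => e.injective (Fin.ext hab)
  have hex : ∀ i : ℕ, i ≤ D → ∃ a, (e a : ℕ) = i := fun i hi =>
    ⟨e.symm ⟨i, by omega⟩, by simp⟩
  have hle : ∀ a, (e a : ℕ) ≤ D := fun a => Nat.lt_succ_iff.1 (e a).isLt
  have hconn : (twinGraph G).Connected :=
    e.connected_iff.2 (SimpleGraph.pathGraph_connected D)
  have hfin : {a : TwinVertex G | TypeKN G a}.Finite := Set.toFinite _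
  have hKN : ∀ a, ¬ Type1 G a → TypeK G a ∨ TypeN G a := fun a ha => (typeKN_iff a).2 ha
  have hK1 : ∀ a, TypeK G a → ¬ Type1 G a := fun a ha => (typeKN_iff a).1 (Or.inl ha)
  have hN1 : ∀ a, TypeN G a → ¬ Type1 G a := fun a ha => (typeKN_iff a).1 (Or.inr ha)
  -- a leaf does not lie in the interior of the path
  have hleaf : ∀ a, IsLeaf (twinGraph G) a ↔ (e a : ℕ) = 0 ∨ (e a : ℕ) = D := by
    intro a
    have ha := hle a
    rw [IsLeaf, Set.ncard_eq_one]
    constructor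
    · rintro ⟨b, hb⟩
      by_contra! hcon
      obtain ⟨c, hc⟩ := hex (e a - 1) (by omega)
      obtain ⟨d, hd⟩ := hex (e a + 1) (by omega)
      have hc' : c ∈ (twinGraph G).neighborSet a := (hadj a c).2 (by omega)
      have hd' : d ∈ (twinGraph G).neighborSet a := (hadj a d).2 (by omega)
      rw [hb, Set.mem_singleton_iff] at hc' hd'
      rw [hc'] at hc
      rw [hd'] at hd
      omega
    · intro h
      obtain ⟨b, hb⟩ := hex (if (e a : ℕ) = 0 then 1 else D - 1) (by split_ifs <;> omega)
      refine ⟨b, Set.ext fun c => ?_⟩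
      rw [SimpleGraph.mem_neighborSet, hadj, Set.mem_singleton_iff]
      have := hle c
      constructor
      · intro hc
        refine hinj _ _ ?_
        split_ifs at hb <;> omega
      · rintro rfl
        split_ifs at hb <;> omega
  rw [alpha]
  set N : Set (TwinVertex G) := {a | TypeKN G a} with hN
  have hmem : ∀ a, a ∈ N ↔ ¬ Type1 G a := typeKN_iff
  constructor
  · rintro (h | ⟨h, hb⟩ | ⟨h, hc⟩ | ⟨h, a, b, c, hbc, hab, hac, ha, hb, hc⟩)
    · rw [Set.ncard_le_one_iff] at h
      by_cases hemp : ∃ a, ¬ Type1 G a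
      · obtain ⟨a, ha⟩ := hemp
        have hall : ∀ b, ¬ Type1 G b → b = a := fun b hb => h ((hmem b).2 hb) ((hmem a).2 ha)
        have := hle a
        rcases hKN a ha with hK | hN'
        · refine Or.inl ⟨min (e a) (D - 1), by omega, fun b hb => ?_⟩
          rw [hall b hb]
          exact ⟨by omega, hK⟩
        · refine Or.inr ⟨max 1 (min (e a) (D - 1)), by omega, by omega, fun b hb => ?_⟩
          rw [hall b hb]
          exact ⟨by omega, fun _ => hN'⟩
      · push Not at hemp
        exact Or.inl ⟨0, by omega, fun a ha => absurd (hemp a) ha⟩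
    · obtain ⟨a, b, hne, hab⟩ := Set.ncard_eq_two.1 h
      have ha1 : ¬ Type1 G a := (hmem a).1 (by rw [hab]; simp)
      have hb1 : ¬ Type1 G b := (hmem b).1 (by rw [hab]; simp)
      have hall : ∀ c, ¬ Type1 G c → c = a ∨ c = b := fun c hc => by
        have := (hmem c).2 hc
        rwa [hab] at this
      -- the classes are ordered along the path
      obtain ⟨a, b, hpos, ha1, hb1, hall, hl₁, hl₂⟩ : ∃ a b, (e a : ℕ) + 1 = e b ∧ ¬ Type1 G a ∧
          ¬ Type1 G b ∧ (∀ c, ¬ Type1 G c → c = a ∨ c = b) ∧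
          (IsLeaf (twinGraph G) a → TypeK G a → TypeK G b) ∧
          (IsLeaf (twinGraph G) b → TypeK G b → TypeK G a) := by
        have h₁ := hb a b hne ha1 hb1
        have h₂ := hb b a hne.symm hb1 ha1
        rcases (hadj a b).1 h₁.1 with hp | hp
        · exact ⟨a, b, hp, ha1, hb1, hall, h₁.2, h₂.2⟩
        · exact ⟨b, a, hp, hb1, ha1, fun c hc => (hall c hc).symm, h₂.2, h₁.2⟩
      rw [hleaf] at hl₁ hl₂
      have hDb := hle b
      -- one of the two classes is the middle of a window if it lies in the interior of the path and
      -- the other one is of type (N)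
      have hcenter : ∀ c, (e c : ℕ) ≠ 0 → (e c : ℕ) ≠ D → (c = a ∨ c = b) →
          (a ≠ c → TypeN G a) → (b ≠ c → TypeN G b) → ∃ i : ℕ, 1 ≤ i ∧ i + 1 ≤ D ∧
          ∀ a, ¬ Type1 G a → ((e a : ℕ) + 1 = i ∨ (e a : ℕ) = i ∨ (e a : ℕ) = i + 1) ∧
          ((e a : ℕ) ≠ i → TypeN G a) := by
        intro c hc0 hcD hc hac hbc
        have := hle c
        refine ⟨e c, by omega, by omega, fun d hd => ?_⟩
        rcases hall d hd with rfl | rfl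
        · exact ⟨by rcases hc with rfl | rfl <;> omega,
            fun hne => hac fun h => hne (by rw [h])⟩
        · exact ⟨by rcases hc with rfl | rfl <;> omega,
            fun hne => hbc fun h => hne (by rw [h])⟩
      rcases hKN a ha1 with hKa | hNa <;> rcases hKN b hb1 with hKb | hNb
      · refine Or.inl ⟨e a, by omega, fun c hc => ?_⟩
        rcases hall c hc with rfl | rfl
        · exact ⟨by omega, hKa⟩
        · exact ⟨by omega, hKb⟩
      · refine Or.inr (hcenter a (fun h0 => ?_) (by omega) (Or.inl rfl) (fun h => absurd rfl h)
          fun _ => hNb)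
        exact (hl₁ (Or.inl h0) hKa).not_typeN hNb
      · refine Or.inr (hcenter b (by omega) (fun h0 => ?_) (Or.inr rfl) (fun _ => hNa)
          fun h => absurd rfl h)
        exact (hl₂ (Or.inr h0) hKb).not_typeN hNa
      · by_cases h0 : (e a : ℕ) = 0
        · exact Or.inr (hcenter b (by omega) (by omega) (Or.inr rfl) (fun _ => hNa) fun _ => hNb)
        · exact Or.inr (hcenter a h0 (by omega) (Or.inl rfl) (fun _ => hNa) fun _ => hNb)
    · obtain ⟨a, b, hne, hab⟩ := Set.ncard_eq_two.1 h
      have ha1 : ¬ Type1 G a := (hmem a).1 (by rw [hab]; simp)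
      have hb1 : ¬ Type1 G b := (hmem b).1 (by rw [hab]; simp)
      obtain ⟨hdist, ha, hb⟩ := hc a b hne ha1 hb1
      obtain ⟨c, hcb, hac⟩ := exists_adj_dist_eq hdist
      rw [SimpleGraph.dist_eq_one_iff_adj, hadj] at hac
      rw [hadj] at hcb
      have hne' : (e a : ℕ) ≠ e b := fun h => hne (hinj _ _ h)
      have h₁ := hle a
      have h₂ := hle b
      refine Or.inr ⟨e c, by omega, by omega, fun d hd => ?_⟩
      have hd' := (hmem d).2 hd
      rw [hab] at hd'
      rcases hd' with rfl | rfl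
      · exact ⟨by omega, fun _ => ha⟩
      · exact ⟨by omega, fun _ => hb⟩
    · have hsub : ({a, b, c} : Set (TwinVertex G)) = N := by
        refine Set.eq_of_subset_of_ncard_le ?_ ?_ hfin
        · rintro d (rfl | rfl | rfl)
          · exact ha
          · exact Or.inr hb
          · exact Or.inr hc
        · rw [h, Set.ncard_eq_three.2 ⟨a, b, c, hab.ne, hac.ne, hbc, rfl⟩]
      rw [hadj] at hab hac
      have hne' : (e b : ℕ) ≠ e c := fun h => hbc (hinj _ _ h)
      have h₁ := hle b
      have h₂ := hle c
      refine Or.inr ⟨e a, by omega, by omega, fun d hd => ?_⟩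
      have hd' := (hmem d).2 hd
      rw [← hsub] at hd'
      rcases hd' with rfl | rfl | rfl
      · exact ⟨by omega, fun h => absurd rfl h⟩
      · exact ⟨by omega, fun _ => hb⟩
      · exact ⟨by omega, fun _ => hc⟩
  · rintro (⟨i, hi, hA⟩ | ⟨i, hi₁, hi, hB⟩)
    · obtain ⟨a, ha⟩ := hex i (by omega)
      obtain ⟨b, hb⟩ := hex (i + 1) hi
      have hsub : N ⊆ {a, b} := fun c hc => by
        rcases (hA c ((hmem c).1 hc)).1 with h | h
        · exact Or.inl (hinj _ _ (h.trans ha.symm))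
        · exact Or.inr (hinj _ _ (h.trans hb.symm))
      have h2 := (Set.ncard_le_ncard hsub (Set.toFinite _)).trans (Set.ncard_insert_le a {b})
      rw [Set.ncard_singleton] at h2
      by_cases h1 : N.ncard ≤ 1
      · exact Or.inl h1
      · refine Or.inr (Or.inl ⟨by omega, fun c d hne hc hd => ?_⟩)
        have h₁ := hA c hc
        have h₂ := hA d hd
        have hne' : (e c : ℕ) ≠ e d := fun h => hne (hinj _ _ h)
        exact ⟨(hadj c d).2 (by omega), fun _ _ => h₂.2⟩
    · obtain ⟨a, ha⟩ := hex i (by omega)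
      obtain ⟨b, hb⟩ := hex (i - 1) (by omega)
      obtain ⟨c, hc⟩ := hex (i + 1) hi
      have hab : a ≠ b := fun h => by rw [h] at ha; omega
      have hac : a ≠ c := fun h => by rw [h] at ha; omega
      have hbc : b ≠ c := fun h => by rw [h] at hb; omega
      have hsub : N ⊆ {a, b, c} := fun d hd => by
        rcases (hB d ((hmem d).1 hd)).1 with h | h | h
        · exact Or.inr (Or.inl (hinj _ _ (by omega)))
        · exact Or.inl (hinj _ _ (by omega))
        · exact Or.inr (Or.inr (hinj _ _ (by omega)))
      have h3 : ({a, b, c} : Set (TwinVertex G)).ncard = 3 :=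
        Set.ncard_eq_three.2 ⟨a, b, c, hab, hac, hbc, rfl⟩
      have hle3 := Set.ncard_le_ncard hsub (Set.toFinite _)
      rw [h3] at hle3
      by_cases h1 : N.ncard ≤ 1
      · exact Or.inl h1
      by_cases h2 : N.ncard = 2
      · by_cases haN : a ∈ N
        · refine Or.inr (Or.inl ⟨h2, fun d d' hne hd hd' => ?_⟩)
          have hBd := hB d hd
          have hBd' := hB d' hd'
          have hne' : (e d : ℕ) ≠ e d' := fun h => hne (hinj _ _ h)
          -- with only two nontrivial classes, one of `d, d'` is the middle class
          have hmid : (e d : ℕ) = i ∨ (e d' : ℕ) = i := by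
            by_contra! hcon
            have hsub' : ({a, d, d'} : Set (TwinVertex G)) ⊆ N := by
              rintro x (rfl | rfl | rfl)
              · exact haN
              · exact (hmem _).2 hd
              · exact (hmem _).2 hd'
            have := Set.ncard_le_ncard hsub' hfin
            rw [Set.ncard_eq_three.2 ⟨a, d, d', fun h => hcon.1 (h ▸ ha),
              fun h => hcon.2 (h ▸ ha), hne, rfl⟩] at this
            omega
          refine ⟨(hadj d d').2 (by omega), fun hl hK => ?_⟩
          rw [hleaf] at hl
          exact absurd (hBd.2 (by omega)) hK.not_typeN
        · refine Or.inr (Or.inr (Or.inl ⟨h2, fun d d' hne hd hd' => ?_⟩))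
          have hBd := hB d hd
          have hBd' := hB d' hd'
          have hne' : (e d : ℕ) ≠ e d' := fun h => hne (hinj _ _ h)
          have hdi : (e d : ℕ) ≠ i := fun h =>
            haN ((hmem a).2 (hinj d a (h.trans ha.symm) ▸ hd))
          have hdi' : (e d' : ℕ) ≠ i := fun h =>
            haN ((hmem a).2 (hinj d' a (h.trans ha.symm) ▸ hd'))
          refine ⟨?_, hBd.2 hdi, hBd'.2 hdi'⟩
          refine dist_eq_two (z := a) hconn hne ?_ ?_ ?_
          · rw [hadj]; omega
          · rw [hadj]; omega
          · rw [hadj]; omega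
      · have heq : N = {a, b, c} :=
          Set.eq_of_subset_of_ncard_le hsub (by omega) (Set.toFinite _)
        have haN : a ∈ N := by rw [heq]; simp
        have hbN : b ∈ N := by rw [heq]; simp
        have hcN : c ∈ N := by rw [heq]; simp
        exact Or.inr (Or.inr (Or.inr ⟨by omega, a, b, c, hbc, (hadj a b).2 (by omega),
          (hadj a c).2 (by omega), haN, (hB b ((hmem b).1 hbN)).2 (by omega),
          (hB c ((hmem c).1 hcN)).2 (by omega)⟩))

theorem extremal_iff_of_iso_path [Finite V] {D : ℕ} (hG : G.Connected) (hD : 3 ≤ D)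
    (e : twinGraph G ≃g SimpleGraph.pathGraph (D + 1)) : Extremal G D ↔
    ((∃ i : ℕ, i + 1 ≤ D ∧ ∀ a, ¬ Type1 G a →
        ((e a : ℕ) = i ∨ (e a : ℕ) = i + 1) ∧ TypeK G a) ∨
      (∃ i : ℕ, 1 ≤ i ∧ i + 1 ≤ D ∧ ∀ a, ¬ Type1 G a →
        ((e a : ℕ) + 1 = i ∨ (e a : ℕ) = i ∨ (e a : ℕ) = i + 1) ∧
          ((e a : ℕ) ≠ i → TypeN G a))) := by
  rw [(isBlowUp_of_iso e).extremal_path_iff hG (by omega)]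
  refine or_congr (exists_congr fun i => and_congr_right fun _ => ?_)
    (exists_congr fun i => and_congr_right fun _ => and_congr_right fun _ => ?_)
  · constructor
    · intro h a ha
      rw [type1_iff] at ha
      push Not at ha
      obtain ⟨x, y, rfl, hy, hne⟩ := ha
      obtain ⟨h₁, h₂⟩ := h x y hne (by rw [hy])
      exact ⟨h₁, (typeK_iff _).2 ⟨x, y, hne, rfl, hy, h₂⟩⟩
    · intro h x y hne hf
      have hst : star G x = star G y := e.injective hf
      obtain ⟨h₁, h₂⟩ := h (star G x) fun h1 => hne ((type1_iff _).1 h1 x y rfl hst.symm)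
      exact ⟨h₁, h₂.2 rfl hst.symm hne⟩
  · constructor
    · intro h a ha
      rw [type1_iff] at ha
      push Not at ha
      obtain ⟨x, y, rfl, hy, hne⟩ := ha
      obtain ⟨h₁, h₂⟩ := h x y hne (by rw [hy])
      exact ⟨h₁, fun h => (typeN_iff _).2 ⟨x, y, hne, rfl, hy, h₂ h⟩⟩
    · intro h x y hne hf
      have hst : star G x = star G y := e.injective hf
      obtain ⟨h₁, h₂⟩ := h (star G x) fun h1 => hne ((type1_iff _).1 h1 x y rfl hst.symm)
      exact ⟨h₁, fun h => (h₂ h).2 rfl hst.symm hne⟩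

theorem extremal_of_pathCase [Finite V] {D : ℕ} (hG : G.Connected) (hD : 3 ≤ D)
    (h : PathCase G D) : Extremal G D := by
  obtain ⟨⟨e⟩, h⟩ := h
  exact (extremal_iff_of_iso_path hG hD e).2 ((pathCase_types_iff hD e).1 h)

theorem IsBlowUp.pathCase [Finite V] {D : ℕ} {f : V → Fin (D + 1)}
    (h : IsBlowUp G (SimpleGraph.pathGraph (D + 1)) f) (hG : G.Connected) (hD : 3 ≤ D)
    (hE : Extremal G D) : PathCase G D := by
  obtain ⟨e, -⟩ := h.exists_iso (twinFree_pathGraph hD)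
  exact ⟨⟨e⟩, (pathCase_types_iff hD e).2 ((extremal_iff_of_iso_path hG hD e).1 hE)⟩

end MetricDim

namespace MetricDim

variable {V : Type*} {G : SimpleGraph V}

/-! ### Blow-ups of a path with one additional vertex -/

section pathPlus

variable {D : ℕ} {S : Set ℕ}

theorem pathPlus_some_some {i j : Fin (D + 1)} :
    (pathPlus D S).Adj (some i) (some j) ↔ (i : ℕ) + 1 = j ∨ (j : ℕ) + 1 = i :=
  SimpleGraph.pathGraph_adj

theorem pathPlus_some_none {i : Fin (D + 1)} : (pathPlus D S).Adj (some i) none ↔ (i : ℕ) ∈ S :=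
  Iff.rfl

theorem pathPlus_none_some {i : Fin (D + 1)} : (pathPlus D S).Adj none (some i) ↔ (i : ℕ) ∈ S :=
  Iff.rfl

theorem pathPlus_none_none : ¬ (pathPlus D S).Adj none none :=
  SimpleGraph.irrefl _

theorem twinFree_pathPlus (hD : 3 ≤ D)
    (hS : ∀ i : Fin (D + 1), ∃ j : Fin (D + 1), j ≠ i ∧
      ¬ (((i : ℕ) + 1 = j ∨ (j : ℕ) + 1 = i) ↔ (j : ℕ) ∈ S)) : TwinFree (pathPlus D S) := by
  rintro (_ | a) (_ | b) hne
  · exact absurd rfl hne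
  · obtain ⟨j, hj, h⟩ := hS b
    refine ⟨some j, by simp, by simpa using hj, ?_⟩
    rw [pathPlus_none_some, pathPlus_some_some]
    exact fun h' => h h'.symm
  · obtain ⟨j, hj, h⟩ := hS a
    refine ⟨some j, by simpa using hj, by simp, ?_⟩
    rwa [pathPlus_none_some, pathPlus_some_some]
  · obtain ⟨c, h₁, h₂, h₃⟩ := twinFree_pathGraph hD a b fun h => hne (by rw [h])
    exact ⟨some c, by simpa using h₁, by simpa using h₂, h₃⟩

theorem twinFree_pathPendant {k : ℕ} (hk : 3 ≤ k) (hkD : k ≤ D - 1) :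
    TwinFree (pathPendant D k) := by
  refine twinFree_pathPlus (by omega) fun i => ?_
  simp only [Set.mem_singleton_iff, Ne, Fin.ext_iff]
  by_cases h₁ : (i : ℕ) = k - 1 ∨ (i : ℕ) = k
  · exact ⟨⟨i + 1, by omega⟩, by dsimp only; omega⟩
  · by_cases h₂ : (i : ℕ) = k - 2
    · exact ⟨⟨k - 3, by omega⟩, by dsimp only; omega⟩
    · exact ⟨⟨k - 1, by omega⟩, by dsimp only; omega⟩

theorem twinFree_pathTriangle {k : ℕ} (hk : 2 ≤ k) (hkD : k ≤ D - 1) :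
    TwinFree (pathTriangle D k) := by
  refine twinFree_pathPlus (by omega) fun i => ?_
  simp only [Set.mem_singleton_iff, Set.mem_insert_iff, Ne, Fin.ext_iff]
  by_cases h₁ : (i : ℕ) = k - 1
  · exact ⟨⟨k - 2, by omega⟩, by dsimp only; omega⟩
  · by_cases h₂ : (i : ℕ) = k
    · exact ⟨⟨k + 1, by omega⟩, by dsimp only; omega⟩
    · rcases Nat.lt_or_ge i k with h | h
      · exact ⟨⟨k, by omega⟩, by dsimp only; omega⟩
      · exact ⟨⟨k - 1, by omega⟩, by dsimp only; omega⟩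

namespace IsBlowUp

variable {f : V → Option (Fin (D + 1))}

/-- Distances to the right of `s`, if the additional vertex is attached to the right of `s`, with
leftmost neighbour `m`. -/
theorem pathPlus_dist_right (h : IsBlowUp G (pathPlus D S) f) (hG : G.Connected) {m : ℕ}
    (hm : m ∈ S) (hmD : m ≤ D) (hS : ∀ i ∈ S, m ≤ i ∧ i ≤ m + 2) {s y : V} {i : Fin (D + 1)}
    (hs : f s = some i) :
    (∀ j : Fin (D + 1), f y = some j → (i : ℕ) < j → G.dist s y = j - i) ∧
    (f y = none → (i : ℕ) ≤ m → G.dist s y = m + 1 - i) := by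
  let L : Option (Fin (D + 1)) → ℕ := fun a => a.elim (m + 1) fun j => j
  have hL : ∀ a b, (pathPlus D S).Adj a b → L b ≤ L a + 1 := by
    rintro (_ | a) (_ | b) hab
    · simp
    · have := hS _ (pathPlus_none_some.1 hab)
      change (b : ℕ) ≤ m + 1 + 1
      omega
    · have := hS _ (pathPlus_some_none.1 hab)
      change m + 1 ≤ (a : ℕ) + 1
      omega
    · rw [pathPlus_some_some] at hab
      change (b : ℕ) ≤ (a : ℕ) + 1
      omega
  have key := h.dist_eq_of_level hG L hL s ?_ y
  · rw [hs] at key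
    constructor
    · intro j hj hij
      rw [hj] at key
      exact key hij
    · intro hy him
      rw [hy] at key
      exact key (Nat.lt_succ_of_le him)
  · rw [hs]
    rintro (_ | b) hb
    · change (i : ℕ) < m + 1 at hb
      refine ⟨some ⟨m, by omega⟩, pathPlus_some_none.2 hm, rfl, fun h => ?_⟩
      exact congrArg some (Fin.ext h)
    · change (i : ℕ) < b at hb
      refine ⟨some ⟨b - 1, by omega⟩, pathPlus_some_some.2 (by dsimp only; omega), ?_, fun h => ?_⟩
      · change (b : ℕ) - 1 + 1 = b
        omega
      · exact congrArg some (Fin.ext h)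

/-- The distance from `s` to the left to the additional vertex with rightmost neighbour `m`. -/
theorem pathPlus_dist_left (h : IsBlowUp G (pathPlus D S) f) (hG : G.Connected) {m : ℕ}
    (hm : m ∈ S) (hmD : m ≤ D) (hS : ∀ i ∈ S, i ≤ m ∧ m ≤ i + 2) {s y : V} {i : Fin (D + 1)}
    (hs : f s = some i) (hy : f y = none) (hmi : m ≤ i) : G.dist s y = i + 1 - m := by
  let L : Option (Fin (D + 1)) → ℕ := fun a => a.elim (D - m + 1) fun j => D - j
  have hL : ∀ a b, (pathPlus D S).Adj a b → L b ≤ L a + 1 := by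
    rintro (_ | a) (_ | b) hab
    · simp
    · have := hS _ (pathPlus_none_some.1 hab)
      change D - (b : ℕ) ≤ D - m + 1 + 1
      omega
    · have := hS _ (pathPlus_some_none.1 hab)
      change D - m + 1 ≤ D - (a : ℕ) + 1
      omega
    · rw [pathPlus_some_some] at hab
      change D - (b : ℕ) ≤ D - (a : ℕ) + 1
      omega
  have key := h.dist_eq_of_level hG L hL s ?_ y
  · rw [hs, hy] at key
    change D - (i : ℕ) < D - m + 1 → G.dist s y = D - m + 1 - (D - (i : ℕ)) at key
    rw [key (by omega)]
    omega
  · rw [hs]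
    rintro (_ | b) hb
    · change D - (i : ℕ) < D - m + 1 at hb
      refine ⟨some ⟨m, by omega⟩, pathPlus_some_none.2 hm, rfl, fun h => ?_⟩
      change D - m = D - (i : ℕ) at h
      exact congrArg some (Fin.ext (by dsimp only; omega))
    · change D - (i : ℕ) < D - (b : ℕ) at hb
      refine ⟨some ⟨b + 1, by omega⟩, pathPlus_some_some.2 (by dsimp only; omega), ?_, fun h => ?_⟩
      · change D - ((b : ℕ) + 1) + 1 = D - (b : ℕ)
        omega
      · change D - ((b : ℕ) + 1) = D - (i : ℕ) at h
        exact congrArg some (Fin.ext (by dsimp only; omega))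

theorem pathPlus_dist (h : IsBlowUp G (pathPlus D S) f) (hG : G.Connected) {m : ℕ}
    (hm : m ∈ S) (hmD : m ≤ D) (hS : ∀ i ∈ S, m ≤ i ∧ i ≤ m + 2) {s y : V} {i j : Fin (D + 1)}
    (hs : f s = some i) (hy : f y = some j) (hij : i ≠ j) :
    G.dist s y = j - i + (i - j) := by
  rw [Ne, Fin.ext_iff] at hij
  rcases Nat.lt_or_gt_of_ne hij with hlt | hlt
  · rw [(h.pathPlus_dist_right hG hm hmD hS hs).1 j hy hlt]
    omega
  · rw [SimpleGraph.dist_comm, (h.pathPlus_dist_right hG hm hmD hS hy).1 i hs hlt]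
    omega

/-- A set of `D + 1` vertices whose complement is resolving meets all fibres but one. -/
theorem exists_mem_of_card_option (h : IsBlowUp G (pathPlus D S) f) (hG : G.Connected)
    {T : Finset V} (hT : OutsideResolved G T) (hcard : T.card = D + 1) :
    ∃ b, ∀ a, a ≠ b → ∃ t ∈ T, f t = a := by
  classical
  have h₁ := Finset.card_image_of_injOn (h.injOn_of_outsideResolved hG hT)
  have h₂ := Finset.card_compl (T.image f)
  rw [h₁, hcard, Fintype.card_option, Fintype.card_fin, Nat.add_sub_cancel_left] at h₂
  obtain ⟨b, hb⟩ := Finset.card_eq_one.1 h₂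
  refine ⟨b, fun a ha => ?_⟩
  have : a ∉ (T.image f)ᶜ := by rw [hb]; simpa using ha
  simpa using this

/-- If all fibres except those in the triangle are trivial and those in the triangle are cliques,
the blow-up is extremal: some two vertices of the triangle are not resolved. -/
theorem extremal_triangle {k : ℕ} (h : IsBlowUp G (pathTriangle D k) f) (hG : G.Connected)
    (hk : 2 ≤ k) (hkD : k ≤ D - 1)
    (htype : ∀ x y, x ≠ y → f x = f y → G.Adj x y ∧
      ∀ i, f x = some i → (i : ℕ) = k - 1 ∨ (i : ℕ) = k) : Extremal G D := by
  intro T hcard hT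
  obtain ⟨b, hb⟩ := h.exists_mem_of_card_option hG hT hcard
  have hright : ∀ i ∈ ({k - 1, k} : Set ℕ), k - 1 ≤ i ∧ i ≤ k - 1 + 2 := by
    rintro i (rfl | rfl) <;> omega
  have hleft : ∀ i ∈ ({k - 1, k} : Set ℕ), i ≤ k ∧ k ≤ i + 2 := by
    rintro i (rfl | rfl) <;> omega
  have hk1 : k - 1 < D + 1 := by omega
  have hk2 : k < D + 1 := by omega
  let tri : Option (Fin (D + 1)) → Prop := fun a => ∀ i, a = some i → (i : ℕ) = k - 1 ∨ (i : ℕ) = k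
  have hadj : ∀ a b, tri a → tri b → a ≠ b → (pathTriangle D k).Adj a b := by
    rintro (_ | i) (_ | j) ha hb hne
    · exact absurd rfl hne
    · exact pathPlus_none_some.2 (hb j rfl)
    · exact pathPlus_some_none.2 (ha i rfl)
    · have h₁ := ha i rfl
      have h₂ := hb j rfl
      have h₃ : (i : ℕ) ≠ j := fun h => hne (congrArg some (Fin.ext h))
      exact pathPlus_some_some.2 (by omega)
  -- an outside vertex over the triangle is adjacent to all vertices of `T` over the triangle
  have hone : ∀ t ∈ T, tri (f t) → ∀ x ∉ T, tri (f x) → G.dist t x = 1 := by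
    intro t ht htt x hx hxt
    rw [SimpleGraph.dist_eq_one_iff_adj]
    by_cases hf : f t = f x
    · exact (htype t x (fun h => hx (h ▸ ht)) hf).1
    · exact h.adj_of_adj (hadj _ _ htt hxt hf)
  have htri : ∀ x ∉ T, f x ≠ b → tri (f x) := by
    intro x hx hxb
    obtain ⟨t, ht, hf⟩ := hb (f x) hxb
    exact (htype x t (fun h => hx (h ▸ ht)) hf.symm).2
  -- it suffices to find two vertices over the triangle at the same distance to the fibre missed
  have main : ∀ c d : Option (Fin (D + 1)), c ≠ d → c ≠ b → d ≠ b → tri c → tri d →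
      (∀ p q x, f p = c → f q = d → f x = b → x ∉ T → ¬ tri b → G.dist p x = G.dist q x) →
      False := by
    intro c d hcd hcb hdb hc hd heq
    obtain ⟨p, hp, hfp⟩ := hb c hcb
    obtain ⟨q, hq, hfq⟩ := hb d hdb
    obtain ⟨x, hx, hr⟩ := hT p hp q hq fun h => hcd (by rw [← hfp, ← hfq, h])
    refine hr ?_
    by_cases hxt : tri (f x)
    · rw [hone p hp (hfp ▸ hc) x hx hxt, hone q hq (hfq ▸ hd) x hx hxt]
    · have hxb : f x = b := by_contra fun h => hxt (htri x hx h)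
      exact heq p q x hfp hfq hxb hx (hxb ▸ hxt)
  have t0 : tri none := fun i hi => by simp at hi
  have t1 : tri (some ⟨k - 1, hk1⟩) := fun i hi => Or.inl (by rw [← Option.some.inj hi])
  have t2 : tri (some ⟨k, hk2⟩) := fun i hi => Or.inr (by rw [← Option.some.inj hi])
  rcases b with _ | i
  · exact main _ _ (by simp; omega) (by simp) (by simp) t1 t2
      fun p q x _ _ _ _ hb => absurd t0 hb
  · rcases Nat.lt_or_ge i k with hi | hi
    · refine main none (some ⟨k, hk2⟩) (by simp) (by simp) ?_ t0 t2 fun p q x hp hq hx _ _ => ?_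
      · simp only [Ne, Option.some.injEq, Fin.ext_iff]
        omega
      · have h₁ := (h.pathPlus_dist_right hG (m := k - 1) (by simp) (by omega) hright hx
          (y := p)).2 hp (by omega)
        have h₂ := (h.pathPlus_dist_right hG (m := k - 1) (by simp) (by omega) hright hx
          (y := q)).1 _ hq hi
        rw [SimpleGraph.dist_comm, h₁, SimpleGraph.dist_comm, h₂]
        dsimp only
        omega
    · refine main none (some ⟨k - 1, hk1⟩) (by simp) (by simp) ?_ t0 t1
        fun p q x hp hq hx _ _ => ?_
      · simp only [Ne, Option.some.injEq, Fin.ext_iff]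
        omega
      · have h₁ := h.pathPlus_dist_left hG (m := k) (by simp) (by omega) hleft hx hp hi
        have h₂ := (h.pathPlus_dist_right hG (m := k - 1) (by simp) (by omega) hright hq
          (y := x)).1 _ hx (by dsimp only; omega)
        rw [SimpleGraph.dist_comm, h₁, h₂]
        dsimp only
        omega

/-- If all fibres except those over the vertex of degree three and its neighbours are trivial and
those over its neighbours are independent, the blow-up is extremal: some two neighbours of the
vertex of degree three are not resolved. -/
theorem extremal_pendant {k : ℕ} (h : IsBlowUp G (pathPendant D k) f) (hG : G.Connected)
    (hk : 3 ≤ k) (hkD : k ≤ D - 1)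
    (htype : ∀ x y, x ≠ y → f x = f y → ∀ i, f x = some i →
      (i : ℕ) + 1 = k - 1 ∨ (i : ℕ) = k - 1 ∨ (i : ℕ) = k)
    (hindep : ∀ x y, f x = f y → (∀ i, f x = some i → (i : ℕ) ≠ k - 1) → ¬ G.Adj x y) :
    Extremal G D := by
  intro T hcard hT
  obtain ⟨b, hb⟩ := h.exists_mem_of_card_option hG hT hcard
  have hright : ∀ i ∈ ({k - 1} : Set ℕ), k - 1 ≤ i ∧ i ≤ k - 1 + 2 := by
    rintro i rfl; omega
  have hleft : ∀ i ∈ ({k - 1} : Set ℕ), i ≤ k - 1 ∧ k - 1 ≤ i + 2 := by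
    rintro i rfl; omega
  have hk0 : k - 2 < D + 1 := by omega
  have hk1 : k - 1 < D + 1 := by omega
  have hk2 : k < D + 1 := by omega
  let nbr : Option (Fin (D + 1)) → Prop := fun a =>
    ∀ i, a = some i → (i : ℕ) + 1 = k - 1 ∨ (i : ℕ) = k
  obtain ⟨m, hm⟩ := h.surj (some ⟨k - 1, hk1⟩)
  have hmadj : ∀ x, nbr (f x) → G.Adj m x := by
    intro x hx
    refine h.adj_of_adj ?_
    rw [hm]
    rcases hfx : f x with _ | i
    · exact pathPlus_some_none.2 rfl
    · have := hx i hfx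
      exact pathPlus_some_some.2 (by dsimp only; omega)
  have hnadj : ∀ x y, nbr (f x) → nbr (f y) → ¬ G.Adj x y := by
    intro x y hx hy
    by_cases hf : f x = f y
    · exact hindep x y hf fun i hi => by have := hx i hi; omega
    · rw [h.adj_iff x y hf]
      rcases hfx : f x with _ | i <;> rcases hfy : f y with _ | j
      · exact pathPlus_none_none
      · have := hy j hfy
        rw [pathPendant, pathPlus_none_some, Set.mem_singleton_iff]
        omega
      · have := hx i hfx
        rw [pathPendant, pathPlus_some_none, Set.mem_singleton_iff]
        omega
      · have := hx i hfx
        have := hy j hfy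
        rw [pathPendant, pathPlus_some_some]
        omega
  -- it suffices to find two neighbours at the same distance to the fibre missed
  have main : ∀ c d : Option (Fin (D + 1)), c ≠ d → c ≠ b → d ≠ b → nbr c → nbr d →
      (∀ p q x i, f p = c → f q = d → f x = b → b = some i → ¬ nbr b → (i : ℕ) ≠ k - 1 →
        G.dist p x = G.dist q x) → False := by
    intro c d hcd hcb hdb hc hd heq
    obtain ⟨p, hp, hfp⟩ := hb c hcb
    obtain ⟨q, hq, hfq⟩ := hb d hdb
    obtain ⟨x, hx, hr⟩ := hT p hp q hq fun h => hcd (by rw [← hfp, ← hfq, h])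
    refine hr ?_
    have hpx : p ≠ x := fun h => hx (h ▸ hp)
    have hqx : q ≠ x := fun h => hx (h ▸ hq)
    rw [← hfp] at hc
    rw [← hfq] at hd
    by_cases hxn : nbr (f x)
    · rw [dist_eq_two hG hpx (hnadj p x hc hxn) (hmadj p hc) (hmadj x hxn),
        dist_eq_two hG hqx (hnadj q x hd hxn) (hmadj q hd) (hmadj x hxn)]
    · obtain ⟨i, hi⟩ : ∃ i, f x = some i := by
        rcases hfx : f x with _ | i
        · exact absurd (fun i hi => by rw [hfx] at hi; simp at hi) hxn
        · exact ⟨i, rfl⟩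
      by_cases hik : (i : ℕ) = k - 1
      · have hmx : f x = f m := by rw [hi, hm, Option.some.injEq]; exact Fin.ext hik
        have hadj : ∀ z, nbr (f z) → G.dist z x = 1 := fun z hz => by
          rw [SimpleGraph.dist_eq_one_iff_adj]
          have hne : f z ≠ f m := fun h => hxn (by rw [hmx, ← h]; exact hz)
          rw [h.adj_iff z x (hmx ▸ hne), hmx, ← h.adj_iff z m hne]
          exact (hmadj z hz).symm
        rw [hadj p hc, hadj q hd]
      · have hxb : f x = b := by
          by_contra hxb
          obtain ⟨t, ht, hf⟩ := hb (f x) hxb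
          have h₁ := htype x t (fun h => hx (h ▸ ht)) hf.symm i hi
          refine hxn fun j hj => ?_
          rw [hi] at hj
          cases hj
          omega
        exact heq p q x i hfp hfq hxb (hxb ▸ hi) (hxb ▸ hxn) hik
  have n0 : nbr none := fun i hi => by simp at hi
  have n1 : nbr (some ⟨k - 2, hk0⟩) := fun i hi => Or.inl (by
    rw [← Option.some.inj hi]; dsimp only; omega)
  have n2 : nbr (some ⟨k, hk2⟩) := fun i hi => Or.inr (by rw [← Option.some.inj hi])
  rcases b with _ | i
  · exact main _ _ (by simp; omega) (by simp) (by simp) n1 n2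
      fun p q x i _ _ _ hi => by simp at hi
  · rcases Nat.lt_or_ge i (k - 1) with hi | hi
    · refine main none (some ⟨k, hk2⟩) (by simp) (by simp) ?_ n0 n2
        fun p q x j hp hq hx _ _ _ => ?_
      · simp only [Ne, Option.some.injEq, Fin.ext_iff]
        omega
      · have h₁ := (h.pathPlus_dist_right hG (m := k - 1) (by simp) (by omega) hright hx
          (y := p)).2 hp (by omega)
        have h₂ := (h.pathPlus_dist_right hG (m := k - 1) (by simp) (by omega) hright hx
          (y := q)).1 _ hq (by dsimp only; omega)
        rw [SimpleGraph.dist_comm, h₁, SimpleGraph.dist_comm, h₂]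
        dsimp only
        omega
    · refine main none (some ⟨k - 2, hk0⟩) (by simp) (by simp) ?_ n0 n1
        fun p q x j hp hq hx _ _ _ => ?_
      · simp only [Ne, Option.some.injEq, Fin.ext_iff]
        omega
      · have h₁ := h.pathPlus_dist_left hG (m := k - 1) (by simp) (by omega) hleft hx hp hi
        have h₂ := (h.pathPlus_dist_right hG (m := k - 1) (by simp) (by omega) hright hq
          (y := x)).1 _ hx (by dsimp only; omega)
        rw [SimpleGraph.dist_comm, h₁, h₂]
        dsimp only
        omega

end IsBlowUp

end pathPlus

end MetricDim

namespace MetricDim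

variable {V : Type*} {G : SimpleGraph V} {D k : ℕ}

/-! ### Types of the twin classes next to the additional vertex -/

theorem pathTriangle_triangle {a b c : Option (Fin (D + 1))} (hab : (pathTriangle D k).Adj a b)
    (hbc : (pathTriangle D k).Adj b c) (hca : (pathTriangle D k).Adj c a) (i : Fin (D + 1))
    (hi : a = some i) : (i : ℕ) = k - 1 ∨ (i : ℕ) = k := by
  subst hi
  rcases b with _ | b <;> rcases c with _ | c <;>
    simp only [pathTriangle, pathPlus_some_some, pathPlus_some_none, pathPlus_none_some,
      Set.mem_insert_iff, Set.mem_singleton_iff] at hab hbc hca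
  · exact hab
  · exact hab
  · exact hca
  · omega

theorem extremal_of_triangleCase [Finite V] (hG : G.Connected) (h : TriangleCase G D) :
    Extremal G D := by
  obtain ⟨k, hk, hkD, ⟨e⟩, x, y, z, hxy, hyz, hzx, hx, hy, hz, h1⟩ := h
  refine (isBlowUp_of_iso e).extremal_triangle hG hk hkD fun v w hne hf => ?_
  have hst : star G v = star G w := e.injective hf
  have hne1 : ¬ Type1 G (star G v) := fun h => hne ((type1_iff _).1 h v w rfl hst.symm)
  have hxy' := e.map_adj_iff.2 hxy
  have hyz' := e.map_adj_iff.2 hyz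
  have hzx' := e.map_adj_iff.2 hzx
  have hmem : star G v = x ∨ star G v = y ∨ star G v = z := by
    by_contra! h
    exact hne1 (h1 _ h.1 h.2.1 h.2.2)
  have hK : Type1K G (star G v) := by rcases hmem with h | h | h <;> rw [h] <;> assumption
  refine ⟨(type1K_iff _).1 hK v w hne rfl hst.symm, ?_⟩
  rcases hmem with h | h | h <;> rw [h]
  · exact pathTriangle_triangle hxy' hyz' hzx'
  · exact pathTriangle_triangle hyz' hzx' hxy'
  · exact pathTriangle_triangle hzx' hxy' hyz'

theorem eq_of_ncard_neighborSet_pathPendant {H : SimpleGraph V} (e : H ≃g pathPendant D k) {c : V}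
    (hc : (H.neighborSet c).ncard = 3) : ∃ i : Fin (D + 1), e c = some i ∧ (i : ℕ) = k - 1 := by
  obtain ⟨x, y, z, hxy, hxz, hyz, hN⟩ := Set.ncard_eq_three.1 hc
  have hmem : ∀ a, a = x ∨ a = y ∨ a = z → (pathPendant D k).Adj (e c) (e a) := fun a ha => by
    rw [e.map_adj_iff, ← SimpleGraph.mem_neighborSet, hN]
    exact ha
  have hx := hmem x (by simp)
  have hy := hmem y (by simp)
  have hz := hmem z (by simp)
  have hxy' := e.injective.ne hxy
  have hxz' := e.injective.ne hxz
  have hyz' := e.injective.ne hyz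
  generalize e c = c' at *
  generalize e x = x' at *
  generalize e y = y' at *
  generalize e z = z' at *
  rcases c' with _ | c' <;> rcases x' with _ | x' <;> rcases y' with _ | y' <;>
    rcases z' with _ | z' <;>
    simp only [pathPendant, pathPlus_some_some, pathPlus_some_none, pathPlus_none_some,
      Set.mem_singleton_iff, pathPlus_none_none, Ne, Option.some.injEq, Fin.ext_iff,
      not_true_eq_false] at hx hy hz hxy' hxz' hyz' <;>
    first
    | exact ⟨c', rfl, by assumption⟩
    | omega

theorem extremal_of_pendantCase [Finite V] (hG : G.Connected) (h : PendantCase G D) :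
    Extremal G D := by
  obtain ⟨k, hk, hkD, ⟨e⟩, c, hc, hN, h1⟩ := h
  obtain ⟨m, hm, hmk⟩ := eq_of_ncard_neighborSet_pathPendant e hc
  have hadj : ∀ a i, e a = some i → (twinGraph G).Adj c a →
      (i : ℕ) + 1 = k - 1 ∨ (i : ℕ) = k := by
    intro a i hi ha
    rw [← e.map_adj_iff, hm, hi, pathPendant, pathPlus_some_some] at ha
    omega
  refine (isBlowUp_of_iso e).extremal_pendant hG hk hkD ?_ ?_
  · intro v w hne hf i hi
    have hst : star G v = star G w := e.injective hf
    have hne1 : ¬ Type1 G (star G v) := fun h => hne ((type1_iff _).1 h v w rfl hst.symm)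
    by_cases hvc : star G v = c
    · rw [hvc, hm, Option.some.injEq] at hi
      rw [← hi]
      exact Or.inr (Or.inl hmk)
    · have ha : (twinGraph G).Adj c (star G v) := by_contra fun h => hne1 (h1 _ hvc h)
      exact (hadj _ i hi ha).imp id Or.inr
  · intro v w hf hv hvw
    have hst : star G v = star G w := e.injective hf
    have hne1 : ¬ Type1 G (star G v) := fun h => hvw.ne ((type1_iff _).1 h v w rfl hst.symm)
    have hvc : star G v ≠ c := fun hvc => hv m (by rw [hvc, hm]) hmk
    have ha : (twinGraph G).Adj c (star G v) := by_contra fun h => hne1 (h1 _ hvc h)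
    exact (type1N_iff _).1 (hN _ ha) v w hvw.ne rfl hst.symm hvw

namespace IsBlowUp

variable {f : V → Option (Fin (D + 1))}

/-- The types of the fibres in an extremal blow-up of a path with a triangle, from the rigidity of
the distance layers of both ends of the path. -/
theorem triangleCase [Finite V] (h : IsBlowUp G (pathTriangle D k) f) (hG : G.Connected)
    (hk : 2 ≤ k) (hkD : k ≤ D - 1) (hE : Extremal G D) : TriangleCase G D := by
  have hright : ∀ i ∈ ({k - 1, k} : Set ℕ), k - 1 ≤ i ∧ i ≤ k - 1 + 2 := by
    rintro i (rfl | rfl) <;> omega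
  have hleft : ∀ i ∈ ({k - 1, k} : Set ℕ), i ≤ k ∧ k ≤ i + 2 := by
    rintro i (rfl | rfl) <;> omega
  have dss : ∀ {x y : V} {i j : Fin (D + 1)}, f x = some i → f y = some j → i ≠ j →
      G.dist x y = j - i + (i - j) := fun hx hy =>
    h.pathPlus_dist hG (m := k - 1) (by simp) (by omega) hright hx hy
  have dsn : ∀ {x y : V} {i : Fin (D + 1)}, f x = some i → f y = none → (i : ℕ) ≤ k - 1 →
      G.dist x y = k - 1 + 1 - i := fun hx hy =>
    (h.pathPlus_dist_right hG (m := k - 1) (by simp) (by omega) hright hx).2 hy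
  have dsn' : ∀ {x y : V} {i : Fin (D + 1)}, f x = some i → f y = none → k ≤ (i : ℕ) →
      G.dist x y = i + 1 - k := fun hx hy =>
    h.pathPlus_dist_left hG (m := k) (by simp) (by omega) hleft hx hy
  obtain ⟨u, hu⟩ := h.surj (some ⟨0, by omega⟩)
  obtain ⟨v, hv⟩ := h.surj (some ⟨D, by omega⟩)
  obtain ⟨p, hp⟩ := h.surj (some ⟨k - 1, by omega⟩)
  obtain ⟨q, hq⟩ := h.surj (some ⟨k, by omega⟩)
  obtain ⟨r, hr⟩ := h.surj none
  have huv : G.dist u v = D := by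
    rw [dss hu hv (by rw [Ne, Fin.ext_iff]; dsimp only; omega)]
    dsimp only
    omega
  have hvu : G.dist v u = D := by rw [SimpleGraph.dist_comm, huv]
  have hur : ∀ {x}, f x = none → G.dist u x = k := fun hx => by
    rw [dsn hu hx (by dsimp only; omega)]; dsimp only; omega
  have huq : ∀ {x}, f x = some ⟨k, by omega⟩ → G.dist u x = k := fun hx => by
    rw [dss hu hx (by rw [Ne, Fin.ext_iff]; dsimp only; omega)]; dsimp only; omega
  have hvr : ∀ {x}, f x = none → G.dist v x = D + 1 - k := fun hx => by
    rw [dsn' hv hx (by dsimp only; omega)]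
  have hvp : ∀ {x}, f x = some ⟨k - 1, by omega⟩ → G.dist v x = D + 1 - k := fun hx => by
    rw [dss hv hx (by rw [Ne, Fin.ext_iff]; dsimp only; omega)]; dsimp only; omega
  have hne_of : ∀ {x y : V}, f x ≠ f y → x ≠ y := fun hxy h => hxy (by rw [h])
  have hqr : G.Adj q r := h.adj_of_adj (by rw [hq, hr]; exact Or.inr rfl)
  have hpr : G.Adj p r := h.adj_of_adj (by rw [hp, hr]; exact Or.inl rfl)
  -- a nontrivial fibre is a clique over the triangle
  have htype : ∀ x y, x ≠ y → f x = f y → G.Adj x y ∧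
      ∀ i, f x = some i → (i : ℕ) = k - 1 ∨ (i : ℕ) = k := by
    intro x y hne hf
    -- the pair `y, z` in a common layer would be resolved by `x`, in the same layer
    have hcl : ∀ {a b z : V}, G.dist a b = D → G.dist a y = G.dist a z → G.dist a y = G.dist a x →
        G.Adj z x → ¬ G.Adj x y → y ≠ z → False := by
      intro a b z hab hyz hyx hzx hxy hyz'
      refine hne (hE.eq_of_resolves hG hab hyz' hyz hne hzx.ne' ?_ hyx).symm
      rw [SimpleGraph.dist_eq_one_iff_adj.2 hzx, Ne, SimpleGraph.dist_eq_one_iff_adj]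
      exact fun h => hxy h.symm
    rcases hfx : f x with _ | i
    · refine ⟨by_contra fun hxy => ?_, fun i hi => by simp at hi⟩
      have hfy : f y = none := hf.symm.trans hfx
      refine hcl (z := q) huv ((hur hfy).trans (huq hq).symm) ((hur hfy).trans (hur hfx).symm) ?_
        hxy (hne_of (by rw [hfy, hq]; simp))
      exact h.adj_of_adj (by rw [hq, hfx]; exact Or.inr rfl)
    · have hfy : f y = some i := hf.symm.trans hfx
      rcases lt_trichotomy (i : ℕ) k with hik | hik | hik
      · by_cases hik' : (i : ℕ) = k - 1
        · have hi' : i = ⟨k - 1, by omega⟩ := Fin.ext hik'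
          refine ⟨by_contra fun hxy => ?_, fun j hj => by cases hj; exact Or.inl hik'⟩
          rw [hi'] at hfx hfy
          refine hcl (z := r) hvu ((hvp hfy).trans (hvr hr).symm) ((hvp hfy).trans (hvp hfx).symm)
            ?_ hxy (hne_of (by rw [hfy, hr]; simp))
          exact h.adj_of_adj (by rw [hr, hfx]; exact Or.inl rfl)
        · exfalso
          have hxv : ∀ {x}, f x = some i → G.dist v x = D - i := fun hx => by
            rw [dss hv hx (by rw [Ne, Fin.ext_iff]; dsimp only; omega)]; dsimp only; omega
          have hpx : p ≠ x :=
            hne_of (by rw [hp, hfx, Ne, Option.some.injEq, Fin.ext_iff]; dsimp only; omega)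
          refine hne (hE.eq_of_resolves hG hvu hpr.ne ((hvp hp).trans (hvr hr).symm)
            hpx.symm (hne_of (by rw [hfx, hr]; simp)) ?_ ((hxv hfy).trans (hxv hfx).symm)).symm
          rw [dss hp hfx (by rw [Ne, Fin.ext_iff]; dsimp only; omega), SimpleGraph.dist_comm,
            dsn hfx hr (by omega)]
          dsimp only
          omega
      · have hi' : i = ⟨k, by omega⟩ := Fin.ext hik
        refine ⟨by_contra fun hxy => ?_, fun j hj => by cases hj; exact Or.inr hik⟩
        rw [hi'] at hfx hfy
        refine hcl (z := r) huv ((huq hfy).trans (hur hr).symm) ((huq hfy).trans (huq hfx).symm)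
          ?_ hxy (hne_of (by rw [hfy, hr]; simp))
        exact h.adj_of_adj (by rw [hr, hfx]; exact Or.inr rfl)
      · exfalso
        have hxu : ∀ {x}, f x = some i → G.dist u x = i := fun hx => by
          rw [dss hu hx (by rw [Ne, Fin.ext_iff]; dsimp only; omega)]; dsimp only; omega
        have hqx : q ≠ x :=
          hne_of (by rw [hq, hfx, Ne, Option.some.injEq, Fin.ext_iff]; dsimp only; omega)
        refine hne (hE.eq_of_resolves hG huv hqr.ne ((huq hq).trans (hur hr).symm)
          hqx.symm (hne_of (by rw [hfx, hr]; simp)) ?_ ((hxu hfy).trans (hxu hfx).symm)).symm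
        rw [dss hq hfx (by rw [Ne, Fin.ext_iff]; dsimp only; omega), SimpleGraph.dist_comm,
          dsn' hfx hr (by omega)]
        dsimp only
        omega
  obtain ⟨e, he⟩ := h.exists_iso (twinFree_pathTriangle hk hkD)
  have hst : ∀ {x y}, star G x = star G y → f x = f y := fun {x y} hxy => by
    rw [← he, ← he, hxy]
  have h1K : ∀ a, Type1K G a := fun a =>
    (type1K_iff a).2 fun x y hne hx hy => (htype x y hne (hst (hx.trans hy.symm))).1
  refine ⟨k, hk, hkD, ⟨e⟩, star G p, star G q, star G r, ?_, ?_, ?_, h1K _, h1K _, h1K _, ?_⟩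
  · rw [← e.map_adj_iff, he, he, hp, hq]
    exact pathPlus_some_some.2 (by dsimp only; omega)
  · rw [← e.map_adj_iff, he, he, hq, hr]
    exact Or.inr rfl
  · rw [← e.map_adj_iff, he, he, hr, hp]
    exact Or.inl rfl
  · intro a hap haq har
    rw [type1_iff]
    intro x y hx hy
    by_contra hne
    subst hx
    have := (htype x y hne (hst hy.symm)).2
    rcases hfx : f x with _ | i
    · exact har (e.injective (by rw [he, he, hfx, hr]))
    · rcases this i hfx with hi | hi
      · exact hap (e.injective (by rw [he, he, hfx, hp]; exact congrArg some (Fin.ext hi)))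
      · exact haq (e.injective (by rw [he, he, hfx, hq]; exact congrArg some (Fin.ext hi)))

/-- The types of the fibres in an extremal blow-up of a path with a pendant vertex, from the
rigidity of the distance layers of both ends of the path. -/
theorem pendantCase [Finite V] (h : IsBlowUp G (pathPendant D k) f) (hG : G.Connected)
    (hk : 3 ≤ k) (hkD : k ≤ D - 1) (hE : Extremal G D) : PendantCase G D := by
  have hright : ∀ i ∈ ({k - 1} : Set ℕ), k - 1 ≤ i ∧ i ≤ k - 1 + 2 := by
    rintro i rfl; omega
  have hleft : ∀ i ∈ ({k - 1} : Set ℕ), i ≤ k - 1 ∧ k - 1 ≤ i + 2 := by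
    rintro i rfl; omega
  have dss : ∀ {x y : V} {i j : Fin (D + 1)}, f x = some i → f y = some j → i ≠ j →
      G.dist x y = j - i + (i - j) := fun hx hy =>
    h.pathPlus_dist hG (m := k - 1) (by simp) (by omega) hright hx hy
  have dsn : ∀ {x y : V} {i : Fin (D + 1)}, f x = some i → f y = none → (i : ℕ) ≤ k - 1 →
      G.dist x y = k - 1 + 1 - i := fun hx hy =>
    (h.pathPlus_dist_right hG (m := k - 1) (by simp) (by omega) hright hx).2 hy
  have dsn' : ∀ {x y : V} {i : Fin (D + 1)}, f x = some i → f y = none → k - 1 ≤ (i : ℕ) →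
      G.dist x y = i + 1 - (k - 1) := fun hx hy =>
    h.pathPlus_dist_left hG (m := k - 1) (by simp) (by omega) hleft hx hy
  obtain ⟨u, hu⟩ := h.surj (some ⟨0, by omega⟩)
  obtain ⟨v, hv⟩ := h.surj (some ⟨D, by omega⟩)
  obtain ⟨p, hp⟩ := h.surj (some ⟨k - 2, by omega⟩)
  obtain ⟨q, hq⟩ := h.surj (some ⟨k, by omega⟩)
  obtain ⟨r, hr⟩ := h.surj none
  obtain ⟨m, hm⟩ := h.surj (some ⟨k - 1, by omega⟩)
  have huv : G.dist u v = D := by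
    rw [dss hu hv (by rw [Ne, Fin.ext_iff]; dsimp only; omega)]
    dsimp only
    omega
  have hvu : G.dist v u = D := by rw [SimpleGraph.dist_comm, huv]
  have hur : ∀ {x}, f x = none → G.dist u x = k := fun hx => by
    rw [dsn hu hx (by dsimp only; omega)]; dsimp only; omega
  have huq : ∀ {x}, f x = some ⟨k, by omega⟩ → G.dist u x = k := fun hx => by
    rw [dss hu hx (by rw [Ne, Fin.ext_iff]; dsimp only; omega)]; dsimp only; omega
  have hvr : ∀ {x}, f x = none → G.dist v x = D + 2 - k := fun hx => by
    rw [dsn' hv hx (by dsimp only; omega)]; dsimp only; omega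
  have hvp : ∀ {x}, f x = some ⟨k - 2, by omega⟩ → G.dist v x = D + 2 - k := fun hx => by
    rw [dss hv hx (by rw [Ne, Fin.ext_iff]; dsimp only; omega)]; dsimp only; omega
  have hne_of : ∀ {x y : V}, f x ≠ f y → x ≠ y := fun hxy h => hxy (by rw [h])
  have hnad : ∀ {x y : V} {i : Fin (D + 1)}, f x = some i → f y = none → (i : ℕ) ≠ k - 1 →
      ¬ G.Adj x y := by
    intro x y i hx hy hi
    rw [h.adj_iff x y (by rw [hx, hy]; simp), hx, hy]
    exact hi
  -- a nontrivial fibre lies over the vertex of degree three or is independent over a neighbour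
  have htype : ∀ x y, x ≠ y → f x = f y →
      (f x = some ⟨k - 1, by omega⟩ ∨ ((f x = none ∨ f x = some ⟨k - 2, by omega⟩ ∨
        f x = some ⟨k, by omega⟩) ∧ ¬ G.Adj x y)) := by
    intro x y hne hf
    -- the pair `y, z` in a common layer would be resolved by `x`, in the same layer
    have hin : ∀ {a b z : V}, G.dist a b = D → G.dist a y = G.dist a z → G.dist a y = G.dist a x →
        ¬ G.Adj z x → x ≠ z → y ≠ z → ¬ G.Adj x y := by
      intro a b z hab hyz hyx hzx hxz hyz' hxy
      refine hne (hE.eq_of_resolves hG hab hyz' hyz hne hxz ?_ hyx).symm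
      rw [SimpleGraph.dist_eq_one_iff_adj.2 hxy.symm]
      exact fun h => hzx (SimpleGraph.dist_eq_one_iff_adj.1 h.symm)
    rcases hfx : f x with _ | i
    · refine Or.inr ⟨Or.inl rfl, ?_⟩
      have hfy : f y = none := hf.symm.trans hfx
      exact hin (z := q) huv ((hur hfy).trans (huq hq).symm) ((hur hfy).trans (hur hfx).symm)
        (hnad hq hfx (by dsimp only; omega)) (hne_of (by rw [hfx, hq]; simp))
        (hne_of (by rw [hfy, hq]; simp))
    · have hfy : f y = some i := hf.symm.trans hfx
      by_cases hi1 : (i : ℕ) = k - 1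
      · exact Or.inl (congrArg some (Fin.ext hi1))
      · have hrx : ¬ G.Adj r x := fun hrx => hnad hfx hr hi1 hrx.symm
        have hxr : x ≠ r := hne_of (by rw [hfx, hr]; simp)
        have hyr : y ≠ r := hne_of (by rw [hfy, hr]; simp)
        refine Or.inr ?_
        rcases lt_trichotomy (i : ℕ) k with hik | hik | hik
        · by_cases hi2 : (i : ℕ) = k - 2
          · have hi' : i = ⟨k - 2, by omega⟩ := Fin.ext hi2
            rw [hi'] at hfx hfy ⊢
            exact ⟨Or.inr (Or.inl rfl), hin (z := r) hvu ((hvp hfy).trans (hvr hr).symm)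
              ((hvp hfy).trans (hvp hfx).symm) hrx hxr hyr⟩
          · exfalso
            have hxv : ∀ {x}, f x = some i → G.dist v x = D - i := fun hx => by
              rw [dss hv hx (by rw [Ne, Fin.ext_iff]; dsimp only; omega)]; dsimp only; omega
            have hpx : p ≠ x :=
              hne_of (by rw [hp, hfx, Ne, Option.some.injEq, Fin.ext_iff]; dsimp only; omega)
            refine hne (hE.eq_of_resolves hG hvu (hne_of (by rw [hp, hr]; simp))
              ((hvp hp).trans (hvr hr).symm) hpx.symm hxr ?_ ((hxv hfy).trans (hxv hfx).symm)).symm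
            rw [dss hp hfx (by rw [Ne, Fin.ext_iff]; dsimp only; omega), SimpleGraph.dist_comm,
              dsn hfx hr (by omega)]
            dsimp only
            omega
        · have hi' : i = ⟨k, by omega⟩ := Fin.ext hik
          rw [hi'] at hfx hfy ⊢
          exact ⟨Or.inr (Or.inr rfl), hin (z := r) huv ((huq hfy).trans (hur hr).symm)
            ((huq hfy).trans (huq hfx).symm) hrx hxr hyr⟩
        · exfalso
          have hxu : ∀ {x}, f x = some i → G.dist u x = i := fun hx => by
            rw [dss hu hx (by rw [Ne, Fin.ext_iff]; dsimp only; omega)]; dsimp only; omega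
          have hqx : q ≠ x :=
            hne_of (by rw [hq, hfx, Ne, Option.some.injEq, Fin.ext_iff]; dsimp only; omega)
          refine hne (hE.eq_of_resolves hG huv (hne_of (by rw [hq, hr]; simp))
            ((huq hq).trans (hur hr).symm) hqx.symm hxr ?_ ((hxu hfy).trans (hxu hfx).symm)).symm
          rw [dss hq hfx (by rw [Ne, Fin.ext_iff]; dsimp only; omega), SimpleGraph.dist_comm,
            dsn' hfx hr (by omega)]
          dsimp only
          omega
  obtain ⟨e, he⟩ := h.exists_iso (twinFree_pathPendant hk hkD)
  have hst : ∀ {x y}, star G x = star G y → f x = f y := fun {x y} hxy => by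
    rw [← he, ← he, hxy]
  have hadj : ∀ x, (twinGraph G).Adj (star G m) (star G x) ↔
      (f x = none ∨ f x = some ⟨k - 2, by omega⟩ ∨ f x = some ⟨k, by omega⟩) := by
    intro x
    rw [← e.map_adj_iff, he, he, hm]
    rcases f x with _ | i
    · simp [pathPendant, pathPlus_some_none]
    · simp only [pathPendant, pathPlus_some_some, reduceCtorEq, Option.some.injEq, Fin.ext_iff,
        false_or]
      omega
  refine ⟨k, hk, hkD, ⟨e⟩, star G m, ?_, ?_, ?_⟩
  · have hse : ∀ {x y}, f x = f y → star G x = star G y := fun hxy =>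
      e.injective (by rw [he, he, hxy])
    refine Set.ncard_eq_three.2 ⟨star G r, star G p, star G q, fun h => ?_, fun h => ?_,
      fun h => ?_, ?_⟩
    · have := hst h
      rw [hr, hp] at this
      simp at this
    · have := hst h
      rw [hr, hq] at this
      simp at this
    · have := hst h
      rw [hp, hq, Option.some.injEq, Fin.ext_iff] at this
      dsimp only at this
      omega
    · ext a
      obtain ⟨x, rfl⟩ : ∃ x, star G x = a := Quotient.exists_rep a
      rw [SimpleGraph.mem_neighborSet, hadj, ← hr, ← hp, ← hq]
      exact ⟨fun h => h.imp hse (Or.imp hse hse), fun h => h.imp hst (Or.imp hst hst)⟩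
  · intro a ha
    rw [type1N_iff]
    intro x y hne hx hy
    subst hx
    rw [hadj] at ha
    rcases htype x y hne (hst hy.symm) with h | h
    · rw [h] at ha
      simp only [reduceCtorEq, Option.some.injEq, Fin.ext_iff, false_or] at ha
      omega
    · exact h.2
  · intro a ham ha
    rw [type1_iff]
    intro x y hx hy
    by_contra hne
    subst hx
    rcases htype x y hne (hst hy.symm) with h | h
    · exact ham (e.injective (by rw [he, he, h, hm]))
    · exact ha ((hadj x).2 h.1)

end IsBlowUp

end MetricDim

namespace MetricDim

variable {V : Type*} {G : SimpleGraph V} {D : ℕ} {u v : V}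

/-! ### The layer structure of an extremal graph -/

/-- The vertex `p` is not adjacent to all vertices of the next distance layer of `u`. -/
def Deficient (G : SimpleGraph V) (u p : V) : Prop :=
  ∃ q, G.dist u q = G.dist u p + 1 ∧ ¬ G.Adj p q

theorem not_deficient_self : ¬ Deficient G u u := by
  rintro ⟨q, hq, hadj⟩
  rw [SimpleGraph.dist_self] at hq
  exact hadj (SimpleGraph.dist_eq_one_iff_adj.1 hq)

theorem adj_of_not_deficient {p q : V} (hp : ¬ Deficient G u p)
    (h : G.dist u q = G.dist u p + 1) : G.Adj p q :=
  by_contra fun hadj => hp ⟨q, h, hadj⟩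

namespace Extremal

theorem layer_adj_iff_left (hE : Extremal G D) (hG : G.Connected) (huv : G.dist u v = D)
    {a b x : V} (ha : G.dist u a = G.dist u x) (hb : G.dist u b = G.dist u x) (hax : a ≠ x)
    (hbx : b ≠ x) : G.Adj a x ↔ G.Adj b x := by
  rcases eq_or_ne a b with rfl | hab
  · rfl
  · have h : G.dist a x = G.dist b x := by
      by_contra h
      exact hax (hE.eq_of_resolves hG huv hab (ha.trans hb.symm) hax.symm hbx.symm h ha)
    rw [← SimpleGraph.dist_eq_one_iff_adj, h, SimpleGraph.dist_eq_one_iff_adj]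

/-- The distance layers are cliques or independent sets. -/
theorem layer_adj_iff (hE : Extremal G D) (hG : G.Connected) (huv : G.dist u v = D)
    {j : ℕ} {x y x' y' : V} (hx : G.dist u x = j) (hy : G.dist u y = j) (hx' : G.dist u x' = j)
    (hy' : G.dist u y' = j) (hxy : x ≠ y) (hxy' : x' ≠ y') : G.Adj x y ↔ G.Adj x' y' := by
  have key : ∀ {a b c}, G.dist u a = j → G.dist u b = j → G.dist u c = j → a ≠ c → b ≠ c →
      (G.Adj a c ↔ G.Adj b c) := fun ha hb hc =>
    hE.layer_adj_iff_left hG huv (ha.trans hc.symm) (hb.trans hc.symm)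
  rcases eq_or_ne x' y with rfl | h
  · rw [key hx hy' hx' hxy hxy'.symm, G.adj_comm]
  · rw [key hx hx' hy hxy h, G.adj_comm, key hy hy' hx' h.symm hxy'.symm, G.adj_comm]

theorem layer_homogeneous (hE : Extremal G D) (hG : G.Connected) (huv : G.dist u v = D)
    {s : Set V} {j : ℕ} (hs : ∀ x ∈ s, G.dist u x = j) : G.IsClique s ∨ G.IsIndepSet s := by
  by_cases h : ∃ x ∈ s, ∃ y ∈ s, x ≠ y ∧ G.Adj x y
  · obtain ⟨x, hx, y, hy, hne, hadj⟩ := h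
    exact Or.inl fun a ha b hb hab => (hE.layer_adj_iff hG huv (hs x hx) (hs y hy) (hs a ha)
      (hs b hb) hne hab).1 hadj
  · push Not at h
    exact Or.inr fun a ha b hb hab => h a ha b hb hab

theorem eq_of_not_adj (hE : Extremal G D) (hG : G.Connected) (huv : G.dist u v = D) {p q y : V}
    (hq : G.dist u q = G.dist u p + 1) (hpq : ¬ G.Adj p q) (hy : G.dist u y = G.dist u q) :
    y = q := by
  obtain ⟨p', hp'q, hp'⟩ := exists_adj_dist_eq hq
  have hpp' : p ≠ p' := fun h => hpq (h ▸ hp'q)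
  have hqp : q ≠ p := fun h => by rw [h] at hq; omega
  refine hE.eq_of_resolves hG huv hpp' hp'.symm hqp hp'q.ne' ?_ hy
  rw [SimpleGraph.dist_eq_one_iff_adj.2 hp'q, Ne, SimpleGraph.dist_eq_one_iff_adj]
  exact hpq

/-- Deficient vertices do not lie on a diametral path that starts in `u`. -/
theorem dist_add_dist_ne_of_deficient (hE : Extremal G D) (hG : G.Connected)
    (huv : G.dist u v = D) (hdiam : ∀ x, G.dist u x ≤ D) {p : V} (hp : Deficient G u p) :
    G.dist u p + G.dist p v ≠ D := by
  obtain ⟨q, hq, hpq⟩ := hp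
  intro h
  have hqD := hdiam q
  obtain ⟨m, hm⟩ : ∃ m, G.dist v p = m + 1 :=
    Nat.exists_eq_succ_of_ne_zero (by rw [SimpleGraph.dist_comm]; omega)
  obtain ⟨z, hzp, hz⟩ := exists_adj_dist_eq hm
  have h₁ := hG.dist_triangle (u := u) (v := z) (w := v)
  have h₂ := Adj.dist_le_succ hG hzp.symm u
  rw [G.dist_comm (u := z), hz] at h₁
  rw [G.dist_comm (u := p), hm] at h
  have := hE.eq_of_not_adj hG huv (y := z) hq hpq (by omega)
  exact hpq (this ▸ hzp.symm)

/-- All deficient vertices belong to one layer: otherwise two of them in different layers, together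
with the interior of a diametral path, are resolved by the ends of that path. -/
theorem dist_eq_of_deficient (hE : Extremal G D) (hG : G.Connected) (huv : G.dist u v = D)
    (hD : 1 ≤ D) (hdiam : ∀ x, G.dist u x ≤ D) {p q : V} (hp : Deficient G u p)
    (hq : Deficient G u q) : G.dist u p = G.dist u q := by
  classical
  by_contra hne
  have hlt : ∀ {p}, Deficient G u p → 0 < G.dist u p ∧ G.dist u p < D := by
    intro p hp
    obtain ⟨z, hz, -⟩ := id hp
    have hzD := hdiam z
    exact ⟨hG.pos_dist_of_ne fun h => not_deficient_self (h ▸ hp : Deficient G u u), by omega⟩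
  have hp' := hE.dist_add_dist_ne_of_deficient hG huv hdiam hp
  have hq' := hE.dist_add_dist_ne_of_deficient hG huv hdiam hq
  choose a ha using fun i : Fin (D - 1) => exists_on_geodesic hG huv (i := i + 1) (by omega)
  have hinj : Function.Injective a := fun i j hij => by
    have h₁ := (ha i).1
    rw [hij, (ha j).1] at h₁
    exact Fin.ext (by omega)
  have hap : ∀ i, a i ≠ p := fun i h => by
    have := ha i
    rw [h] at this
    omega
  have haq : ∀ i, a i ≠ q := fun i h => by
    have := ha i
    rw [h] at this
    omega
  have hpq : p ≠ q := fun h => hne (by rw [h])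
  set T : Finset V := insert p (insert q (Finset.univ.image a)) with hT
  have hmem : ∀ x, x ∈ T ↔ x = p ∨ x = q ∨ ∃ i, a i = x := by simp [hT]
  have hpos : ∀ x ∈ T, 0 < G.dist u x ∧ G.dist u x < D := by
    intro x hx
    rcases (hmem x).1 hx with rfl | rfl | ⟨i, rfl⟩
    · exact hlt hp
    · exact hlt hq
    · rw [(ha i).1]
      omega
  have huT : u ∉ T := fun h => by
    have := hpos u h
    rw [SimpleGraph.dist_self] at this
    omega
  have hvT : v ∉ T := fun h => by
    have := hpos v h
    omega
  refine hE T ?_ fun x hx y hy hxy => ?_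
  · rw [hT, Finset.card_insert_of_notMem, Finset.card_insert_of_notMem,
      Finset.card_image_of_injective _ hinj, Finset.card_univ, Fintype.card_fin]
    · omega
    · simpa using haq
    · simpa [hpq] using hap
  · by_cases h : G.dist u x = G.dist u y
    · refine ⟨v, hvT, ?_⟩
      rw [Resolves]
      rcases (hmem x).1 hx with rfl | rfl | ⟨i, rfl⟩ <;>
        rcases (hmem y).1 hy with rfl | rfl | ⟨j, rfl⟩
      · exact absurd rfl hxy
      · exact absurd h hne
      · have := ha j
        omega
      · exact absurd h.symm hne
      · exact absurd rfl hxy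
      · have := ha j
        omega
      · have := ha i
        omega
      · have := ha i
        omega
      · rw [(ha i).1, (ha j).1] at h
        exact absurd (congrArg a (Fin.ext (by omega))) hxy
    · refine ⟨u, huT, ?_⟩
      rwa [Resolves, G.dist_comm, G.dist_comm (u := y)]

/-- Without deficient vertices, the layers are the fibres of a blow-up of a path. -/
theorem exists_isBlowUp_path (hE : Extremal G D) (hG : G.Connected) (huv : G.dist u v = D)
    (hdiam : ∀ x, G.dist u x ≤ D) (hdef : ∀ p, ¬ Deficient G u p) :
    ∃ f : V → Fin (D + 1), IsBlowUp G (SimpleGraph.pathGraph (D + 1)) f := by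
  refine ⟨fun x => ⟨G.dist u x, Nat.lt_succ_of_le (hdiam x)⟩, ⟨?_, ?_, ?_⟩⟩
  · intro i
    obtain ⟨w, hw, -⟩ := exists_on_geodesic hG huv (Nat.lt_succ_iff.1 i.isLt)
    exact ⟨w, Fin.ext hw⟩
  · intro x y hne
    rw [Ne, Fin.ext_iff] at hne
    rw [SimpleGraph.pathGraph_adj]
    constructor
    · intro h
      have h₁ := Adj.dist_le_succ hG h u
      have h₂ := Adj.dist_le_succ hG h.symm u
      dsimp only at hne ⊢
      omega
    · rintro (h | h)
      · exact adj_of_not_deficient (hdef x) h.symm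
      · exact (adj_of_not_deficient (hdef y) h.symm).symm
  · intro i
    exact hE.layer_homogeneous hG huv (j := i) fun x hx => congrArg Fin.val hx

/-- If there are deficient vertices, they are the fibre over the additional vertex of a path with
one additional vertex, and the other vertices of each layer form the fibres over the path. -/
theorem exists_isBlowUp_pathPlus (hE : Extremal G D) (hG : G.Connected) (huv : G.dist u v = D)
    (hD : 1 ≤ D) (hdiam : ∀ x, G.dist u x ≤ D) {p : V} (hp : Deficient G u p) {S : Set ℕ}
    (hS : ∀ i, i ∈ S ↔ i + 1 = G.dist u p ∨ (i = G.dist u p ∧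
      ∃ x y, x ≠ y ∧ G.dist u x = i ∧ G.dist u y = i ∧ G.Adj x y)) :
    ∃ f : V → Option (Fin (D + 1)), IsBlowUp G (pathPlus D S) f ∧
      (∀ x, f x = none → Deficient G u x) ∧ ∀ x i, f x = some i → G.dist u x = i := by
  classical
  let f : V → Option (Fin (D + 1)) := fun x =>
    if Deficient G u x then none else some ⟨G.dist u x, Nat.lt_succ_of_le (hdiam x)⟩
  have hnone : ∀ x, f x = none → Deficient G u x := by
    intro x hx
    by_contra h
    simp [f, h] at hx
  have hnone' : ∀ x, Deficient G u x → f x = none := fun x hx => if_pos hx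
  have hsome : ∀ x i, f x = some i → ¬ Deficient G u x ∧ G.dist u x = i := by
    intro x i hx
    by_cases h : Deficient G u x
    · simp [f, h] at hx
    · simp only [f, h, if_false, Option.some.injEq] at hx
      exact ⟨h, congrArg Fin.val hx⟩
  have hsome' : ∀ x, ¬ Deficient G u x →
      f x = some ⟨G.dist u x, Nat.lt_succ_of_le (hdiam x)⟩ := fun x hx => if_neg hx
  have hlayer : ∀ x, Deficient G u x → G.dist u x = G.dist u p := fun x hx =>
    hE.dist_eq_of_deficient hG huv hD hdiam hx hp
  obtain ⟨q, hq, hpq⟩ := id hp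
  have halone : ∀ y, G.dist u y = G.dist u q → y = q := fun y hy =>
    hE.eq_of_not_adj hG huv hq hpq hy
  have hnq : ∀ x, Deficient G u x → ¬ G.Adj x q := by
    rintro x hx
    obtain ⟨z, hz, hxz⟩ := id hx
    rwa [halone z (by rw [hz, hq, hlayer x hx])] at hxz
  have hcross : ∀ x y, Deficient G u x → ¬ Deficient G u y →
      (G.Adj x y ↔ G.dist u y ∈ S) := by
    intro x y hx hy
    have hxp := hlayer x hx
    rw [hS, ← hxp]
    constructor
    · intro hadj
      have h₁ := Adj.dist_le_succ hG hadj u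
      have h₂ := Adj.dist_le_succ hG hadj.symm u
      rcases lt_trichotomy (G.dist u y) (G.dist u x) with h | h | h
      · exact Or.inl (by omega)
      · exact Or.inr ⟨h, x, y, hadj.ne, h.symm, rfl, hadj⟩
      · rw [halone y (by omega)] at hadj
        exact absurd hadj (hnq x hx)
    · rintro (h | ⟨h, a, b, hab, ha, hb, hadj⟩)
      · exact (adj_of_not_deficient hy h.symm).symm
      · exact (hE.layer_adj_iff hG huv ha hb h.symm rfl hab fun hxy => hy (hxy ▸ hx)).1 hadj
  refine ⟨f, ⟨?_, ?_, ?_⟩, hnone, fun x i hx => (hsome x i hx).2⟩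
  · rintro (_ | i)
    · exact ⟨p, hnone' p hp⟩
    · obtain ⟨w, hw, hwd⟩ : ∃ w, G.dist u w = i ∧ ¬ Deficient G u w := by
        by_cases hi : (i : ℕ) = G.dist u p
        · obtain ⟨w, hwq, hw⟩ := exists_adj_dist_eq hq
          exact ⟨w, hw.trans hi.symm, fun h => hnq w h hwq⟩
        · obtain ⟨w, hw, -⟩ := exists_on_geodesic hG huv (Nat.lt_succ_iff.1 i.isLt)
          exact ⟨w, hw, fun h => hi (hw.symm.trans (hlayer w h))⟩
      exact ⟨w, (hsome' w hwd).trans (congrArg some (Fin.ext hw))⟩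
  · intro x y hne
    by_cases hx : Deficient G u x <;> by_cases hy : Deficient G u y
    · exact absurd ((hnone' x hx).trans (hnone' y hy).symm) hne
    · rw [hcross x y hx hy, hnone' x hx, hsome' y hy]
      rfl
    · rw [G.adj_comm, hcross y x hy hx, hnone' y hy, hsome' x hx]
      rfl
    · rw [hsome' x hx, hsome' y hy, Ne, Option.some.injEq, Fin.ext_iff] at hne
      dsimp only at hne
      rw [hsome' x hx, hsome' y hy, pathPlus_some_some]
      constructor
      · intro h
        have h₁ := Adj.dist_le_succ hG h u
        have h₂ := Adj.dist_le_succ hG h.symm u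
        dsimp only
        omega
      · rintro (h | h)
        · exact adj_of_not_deficient hx h.symm
        · exact (adj_of_not_deficient hy h.symm).symm
  · rintro (_ | i)
    · exact hE.layer_homogeneous hG huv fun x hx => hlayer x (hnone x hx)
    · exact hE.layer_homogeneous hG huv fun x hx => (hsome x i hx).2

end Extremal

/-- If the additional vertex and the initial vertex of the path have the same neighbours among the
other vertices of the path, they can be merged. -/
theorem IsBlowUp.merge {S : Set ℕ} {f : V → Option (Fin (D + 1))}
    (h : IsBlowUp G (pathPlus D S) f) (hS : ∀ i, 1 ≤ i → (i ∈ S ↔ i = 1))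
    (hom : G.IsClique {x | f x = none ∨ f x = some 0} ∨
      G.IsIndepSet {x | f x = none ∨ f x = some 0}) :
    IsBlowUp G (SimpleGraph.pathGraph (D + 1)) fun x => (f x).getD 0 := by
  have hS' : ∀ i : Fin (D + 1), i ≠ 0 → ((i : ℕ) ∈ S ↔ (i : ℕ) = 1) := fun i hi =>
    hS i (Nat.one_le_iff_ne_zero.2 fun h => hi (Fin.ext h))
  refine ⟨fun i => ?_, fun x y hne => ?_, fun i => ?_⟩
  · obtain ⟨x, hx⟩ := h.surj (some i)
    exact ⟨x, by rw [hx]; rfl⟩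
  · have hne' : f x ≠ f y := fun h => hne (by rw [h])
    rw [h.adj_iff x y hne', SimpleGraph.pathGraph_adj]
    clear hne'
    generalize f x = a at hne ⊢
    generalize f y = b at hne ⊢
    rcases a with _ | i <;> rcases b with _ | j
    · exact absurd rfl hne
    · have := hS' j (Ne.symm hne)
      rw [pathPlus_none_some, this]
      simp only [Option.getD_none, Option.getD_some, Fin.val_zero]
      omega
    · have := hS' i hne
      rw [pathPlus_some_none, this]
      simp only [Option.getD_none, Option.getD_some, Fin.val_zero]
      omega
    · exact pathPlus_some_some
  · by_cases hi : i = 0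
    · have : (fun x => (f x).getD 0) ⁻¹' {i} = {x | f x = none ∨ f x = some 0} := by
        ext x
        rw [hi]
        rcases hx : f x with _ | j <;> simp [hx]
      rwa [this]
    · have : (fun x => (f x).getD 0) ⁻¹' {i} = f ⁻¹' {some i} := by
        ext x
        rcases hx : f x with _ | j
        · simp [hx, Ne.symm hi]
        · simp [hx]
      rw [this]
      exact h.homogeneous _

/-- An extremal graph is a blow-up of a path or falls under one of the other two cases. -/
theorem Extremal.cases [Finite V] (hE : Extremal G D) (hG : G.Connected) (huv : G.dist u v = D)
    (hD : 3 ≤ D) (hdiam : ∀ x y, G.dist x y ≤ D) :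
    PathCase G D ∨ PendantCase G D ∨ TriangleCase G D := by
  by_cases hdef : ∀ p, ¬ Deficient G u p
  · obtain ⟨f, hf⟩ := hE.exists_isBlowUp_path hG huv (hdiam u) hdef
    exact Or.inl (hf.pathCase hG hD hE)
  push Not at hdef
  obtain ⟨p, hp⟩ := hdef
  obtain ⟨q, hq, hpq⟩ := id hp
  have hlayer : ∀ x, Deficient G u x → G.dist u x = G.dist u p := fun x hx =>
    hE.dist_eq_of_deficient hG huv (by omega) (hdiam u) hx hp
  have hpos : 0 < G.dist u p :=
    hG.pos_dist_of_ne fun h => not_deficient_self (h ▸ hp : Deficient G u u)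
  have hpD : G.dist u p + 1 ≤ D := hq ▸ hdiam u q
  have hzero : ∀ {x}, G.dist u x = 0 → x = u := fun hx => (hG.dist_eq_zero_iff.1 hx).symm
  by_cases hcl : ∃ x y, x ≠ y ∧ G.dist u x = G.dist u p ∧ G.dist u y = G.dist u p ∧ G.Adj x y
  · have hcl' := hcl
    obtain ⟨a, b, hab, ha, hb, hadj⟩ := hcl'
    obtain ⟨f, hf, hnone, hsome⟩ := hE.exists_isBlowUp_pathPlus hG huv (by omega) (hdiam u) hp
      (S := {G.dist u p - 1, G.dist u p}) (fun i => by
        rw [Set.mem_insert_iff, Set.mem_singleton_iff]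
        refine or_congr (by omega) ⟨fun h => ⟨h, h ▸ hcl⟩, fun h => h.1⟩)
    by_cases h1 : G.dist u p = 1
    · rw [h1] at hf
      refine Or.inl ((hf.merge (fun i hi => ?_) (Or.inl fun x hx y hy hxy => ?_)).pathCase hG hD hE)
      · rw [Set.mem_insert_iff, Set.mem_singleton_iff]
        omega
      · rcases hx with hx | hx <;> rcases hy with hy | hy
        · exact (hE.layer_adj_iff hG huv ha hb (hlayer x (hnone x hx)) (hlayer y (hnone y hy)) hab
            hxy).1 hadj
        · rw [hzero (hsome y 0 hy)]
          exact (SimpleGraph.dist_eq_one_iff_adj.1 ((hlayer x (hnone x hx)).trans h1)).symm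
        · rw [hzero (hsome x 0 hx)]
          exact SimpleGraph.dist_eq_one_iff_adj.1 ((hlayer y (hnone y hy)).trans h1)
        · exact absurd ((hzero (hsome x 0 hx)).trans (hzero (hsome y 0 hy)).symm) hxy
    · exact Or.inr (Or.inr (IsBlowUp.triangleCase hf hG (by omega) (by omega) hE))
  · obtain ⟨f, hf, hnone, hsome⟩ := hE.exists_isBlowUp_pathPlus hG huv (by omega) (hdiam u) hp
      (S := {G.dist u p - 1}) (fun i => by
        rw [Set.mem_singleton_iff]
        refine ⟨fun h => Or.inl (by omega), ?_⟩
        rintro (h | ⟨rfl, h⟩)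
        · omega
        · exact absurd h hcl)
    have hind : ∀ x y, G.dist u x = G.dist u p → G.dist u y = G.dist u p → ¬ G.Adj x y :=
      fun x y hx hy hxy => hcl ⟨x, y, hxy.ne, hx, hy, hxy⟩
    rcases lt_trichotomy (G.dist u p) 2 with h2 | h2 | h2
    -- a deficient vertex in the first, independent layer would have distance `D + 1` from `v`
    · exfalso
      have h₁ := hE.dist_add_dist_ne_of_deficient hG huv (hdiam u) hp
      have h₂ := hG.dist_triangle (u := u) (v := p) (w := v)
      have h₃ := hdiam p v
      obtain ⟨z, hzp, hz⟩ := exists_adj_dist_eq (G := G) (u := v) (v := p) (m := D - 1)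
        (by rw [SimpleGraph.dist_comm]; omega)
      have h₄ := Adj.dist_le_succ hG hzp.symm u
      rcases Nat.lt_or_ge (G.dist u z) (G.dist u p) with h₅ | h₅
      · rw [hzero (x := z) (by omega), SimpleGraph.dist_comm] at hz
        omega
      · rcases Nat.eq_or_lt_of_le h₅ with h₆ | h₆
        · exact hind z p h₆.symm rfl hzp
        · have := hE.eq_of_not_adj hG huv (y := z) hq hpq (by omega)
          exact hpq (this ▸ hzp.symm)
    · rw [h2] at hf
      refine Or.inl ((hf.merge (fun i hi => ?_) (Or.inr fun x hx y hy hxy hadj => ?_)).pathCase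
        hG hD hE)
      · rw [Set.mem_singleton_iff]
      · have h₁ := Adj.dist_le_succ hG hadj u
        have h₂ := Adj.dist_le_succ hG hadj.symm u
        rcases hx with hx | hx <;> rcases hy with hy | hy
        · exact hind x y (hlayer x (hnone x hx)) (hlayer y (hnone y hy)) hadj
        · rw [hlayer x (hnone x hx), hsome y 0 hy, Fin.val_zero] at h₂
          omega
        · rw [hlayer y (hnone y hy), hsome x 0 hx, Fin.val_zero] at h₁
          omega
        · exact hxy ((hzero (hsome x 0 hx)).trans (hzero (hsome y 0 hy)).symm)
    · exact Or.inr (Or.inl (IsBlowUp.pendantCase hf hG (by omega) (by omega) hE))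

end MetricDim

theorem mainTheorem1 {V : Type*} [Fintype V] (G : SimpleGraph V) (hG : G.Connected)
    (n D : ℕ) (hn : Fintype.card V = n) (hD : G.diam = D) (hD3 : 3 ≤ D) :
    (MetricDim.metricDimension G : ℤ) = (n : ℤ) - (D : ℤ) ↔
      MetricDim.PathCase G D ∨ MetricDim.PendantCase G D ∨ MetricDim.TriangleCase G D := by
  have : Nonempty V := hG.nonempty
  obtain ⟨u, v, huv⟩ := G.exists_dist_eq_diam
  have hdiam : ∀ x y, G.dist x y ≤ D := fun x y => hD ▸ SimpleGraph.dist_le_diam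
    (SimpleGraph.ediam_ne_top_of_diam_ne_zero (by omega))
  rw [hD] at huv
  rw [← hn, MetricDim.metricDimension_eq_iff_extremal hG huv]
  constructor
  · exact fun hE => hE.cases hG huv hD3 hdiam
  · rintro (h | h | h)
    · exact MetricDim.extremal_of_pathCase hG hD3 h
    · exact MetricDim.extremal_of_pendantCase hG h
    · exact MetricDim.extremal_of_triangleCase hG h
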